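/- Let $h\ge 2$ and $\mathcal F=\{(i,j):1\le i<j\le h\}$. For $(i,j)\in\mathcal F$ put $\overline\Phi(i,j)=\{(i',j')\in\mathcal F: i'\le i<j\le j'\}$ and $\Phi(i,j)=\overline\Phi(i,j)\setminus\{(i,j)\}$, and for $S\subseteq\mathcal F$ put $\mathcal J_S=\{(i,j)\in\mathcal F:\overline\Phi(i,j)\cap S\neq\emptyset\}$. Let $Q$ be a joint pmf of random variables $\mathbf A=(A_s)_{s\in\mathcal F}$ and $X_1,\dots,X_h$ with finite alphabets such that for every $s\in\mathcal F$, given $A_{\Phi(s)}$ the variable $A_s$ is independent of the family of those $A_r$ for which $r\ne s$, $r\notin\Phi(s)$ and $s\notin\Phi(r)$. Let $\mu^+_s,\mu^-_s\ge 0$ for $s\in\mathcal F$, and for $n\in\mathbb N$ let $\mathcal M^{\pm}_s=\{1,\dots,\lfloor 2^{n\mu_s^+}\rfloor\}\times\{1,\dots,\lfloor 2^{n\mu_s^-}\rfloor\}$, with elements $m_s^\pm=(m_s^+,m_s^-)$; write $\mathbf m^\pm=(m^\pm_s)_{s\in\mathcal F}$, $\mathbf m^-=(m^-_s)_{s\in\mathcal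 F}$, and $\mathbf m^\pm_T=(m_s^\pm)_{s\in T}$ for $T\subseteq\mathcal F$. Random $A$-codebooks of block length $n$ are built in layers, starting from $(1,h)$, the codebook for $s$ after those for all $r\in\Phi(s)$: for every $s\in\mathcal F$ and every $\mathbf m^\pm_{\overline\Phi(s)}$, a codeword $A^n_s(\mathbf m^\pm_{\overline\Phi(s)})$ is drawn, conditionally independently of the other codewords of the codebook for $s$ and of those of the codebooks for $r\notin\Phi(s)$ built before, from the memoryless conditional pmf $Q^{\otimes n}_{A_s|A_{\Phi(s)}}$ given the codewords $A_r^n(\mathbf m^\pm_{\overline\Phi(r)})$, $r\in\Phi(s)$. Write $\mathbf A^n(\mathbf m^\pm)=(A^n_s(\mathbf m^\pm_{\overline\Phi(s)}))_{s\in\mathcal F}$. For given codebooks, let $\widehat Q_{\hat X_1^n\cdots\hat X_h^n}$ be the average of $Q^{\otimes n}_{X_1\cdots X_h|\mathbf A}(\cdot\,|\,\mathbf A^n(\mathbf m^\pm))$ over all $\mathbf m^\pm$ (uniformly), let $\widehat Q_{\hat X_1^n}$ be its $\hat X_1^n$-marginal (the average of $Q^{\otimes n}_{X_1|\mathbf A}(\cdot\,|\,\mathbf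 A^n(\mathbf m^\pm))$ over all $\mathbf m^\pm$), and let $\widehat Q_{\hat X_1^n|\mathbf M^-}(\cdot\,|\,\mathbf m^-)$ be the average of $Q^{\otimes n}_{X_1|\mathbf A}(\cdot\,|\,\mathbf A^n(\mathbf m^\pm))$ over all $\mathbf m^\pm$ with the given $\mathbf m^-$. Let $\mathbb E$ denote the expectation over the random codebooks. Mutual information is in bits. (1) If for every $S\subseteq\mathcal F$ with $(1,h)\notin S$ $$\sum_{s\in\mathcal F\setminus S}(\mu_s^++\mu_s^-)>I\big(X_1,\dots,X_h;A_{\mathcal J_S^c}\big),$$ then $$\lim_{n\to\infty}\mathbb E\Big[D_{\mathrm{KL}}\big(\widehat Q_{\hat X_1^n\cdots\hat X_h^n}\,\big\|\,Q^{\otimes n}_{X_1\cdots X_h}\big)\Big]=0.$$ (2) If for every $S\subseteq\mathcal F$ with $(1,h)\notin S$ $$\sum_{s\in\mathcal F\setminus S}\mu_s^+>I\big(X_1;A_{\mathcal J_S^c}\big),$$ then $\hat X_1^n$ is asymptotically independent of the common-randomness indices $\mathbf M^-$ in the sense that $$\lim_{n\to\infty}\ \frac1{\prod_{s\in\mathcal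 F}\lfloor 2^{n\mu^-_s}\rfloor}\sum_{\mathbf m^-}\mathbb E\Big[D_{\mathrm{KL}}\big(\widehat Q_{\hat X_1^n|\mathbf M^-}(\cdot\,|\,\mathbf m^-)\,\big\|\,\widehat Q_{\hat X_1^n}\big)\Big]=0.$$ -/

import Mathlib

open Filter Topology

namespace LineCoord

/-! ### Finite probability: laws, conditional laws, Markov chains, information measures

A pmf on a finite type `Ω` is a function `Q : Ω → ℝ` with `Q ∈ stdSimplex ℝ Ω`, and a random
variable on `(Ω, Q)` is a function on `Ω`. -/

section Probability

variable {Ω β γ δ : Type*} [Fintype Ω]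

open Classical in
/-- The law (pmf) of the random variable `f`: `law Q f b = P(f = b)`. -/
noncomputable def law (Q : Ω → ℝ) (f : Ω → β) (b : β) : ℝ :=
  ∑ ω with f ω = b, Q ω

/-- The conditional pmf `P(f = b | g = d)` (it is `0` where `P(g = d) = 0`). -/
noncomputable def cond (Q : Ω → ℝ) (f : Ω → β) (g : Ω → γ) (b : β) (d : γ) : ℝ :=
  law Q (fun ω => (f ω, g ω)) (b, d) / law Q g d

/-- The Markov chain `f — k — g`: `f` and `g` are conditionally independent given `k`. -/
def MarkovChain (Q : Ω → ℝ) (f : Ω → β) (k : Ω → δ) (g : Ω → γ) : Prop :=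
  ∀ b d c, law Q (fun ω => (f ω, k ω, g ω)) (b, d, c) * law Q k d =
    law Q (fun ω => (f ω, k ω)) (b, d) * law Q (fun ω => (k ω, g ω)) (d, c)

/-- The mutual information `I(f; g)`, in bits. -/
noncomputable def mutualInfo [Fintype β] [Fintype γ] (Q : Ω → ℝ) (f : Ω → β) (g : Ω → γ) : ℝ :=
  ∑ b, ∑ c, law Q (fun ω => (f ω, g ω)) (b, c) *
    Real.logb 2 (law Q (fun ω => (f ω, g ω)) (b, c) / (law Q f b * law Q g c))

open Classical in
/-- The Kullback–Leibler divergence of two pmfs on a finite type, in bits; it is `⊤` unless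
`supp p ⊆ supp q`. -/
noncomputable def klDiv [Fintype β] (p q : β → ℝ) : EReal :=
  if ∀ b, q b = 0 → p b = 0 then ((∑ b, p b * Real.logb 2 (p b / q b) : ℝ) : EReal) else ⊤

end Probability

/-! ### Pairs of nodes -/

/-- The pairs `(i, j)` of nodes with `i < j`; nodes `1, …, h` are the elements of `Fin h`. -/
abbrev Pair (h : ℕ) : Type := {p : Fin h × Fin h // p.1 < p.2}

/-- Node `1`. -/
def firstNode {h : ℕ} (hh : 2 ≤ h) : Fin h := ⟨0, by omega⟩

/-- The pair `(1, h)`. -/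
def topPair {h : ℕ} (hh : 2 ≤ h) : Pair h :=
  ⟨(⟨0, by omega⟩, ⟨h - 1, by omega⟩), Fin.mk_lt_mk.mpr (by omega)⟩

/-- `Φ̄(i, j)`: the pairs `(i', j')` with `i' ≤ i < j ≤ j'`. -/
def phiBar {h : ℕ} (s : Pair h) : Finset (Pair h) :=
  Finset.univ.filter fun r => r.1.1 ≤ s.1.1 ∧ s.1.2 ≤ r.1.2

/-- `Φ(i, j) = Φ̄(i, j) \ {(i, j)}`. -/
def phi {h : ℕ} (s : Pair h) : Finset (Pair h) := (phiBar s).erase s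

/-- `J_S`: the pairs `(i, j)` such that `Φ̄(i, j)` meets `S`. -/
def jSet {h : ℕ} (S : Finset (Pair h)) : Finset (Pair h) :=
  Finset.univ.filter fun s => (phiBar s ∩ S).Nonempty

/-- The pairs that are neither `s` itself, nor in `Φ(s)`, nor have `s` in their `Φ`. -/
def unrelated {h : ℕ} (s : Pair h) : Finset (Pair h) :=
  Finset.univ.filter fun r => r ∉ phiBar s ∧ s ∉ phiBar r

theorem phiBar_subset {h : ℕ} {r s : Pair h} (hr : r ∈ phi s) : phiBar r ⊆ phiBar s := by
  intro t ht
  simp only [phi, phiBar, Finset.mem_erase, Finset.mem_filter, Finset.mem_univ, true_and]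
    at hr ht ⊢
  exact ⟨ht.1.trans hr.2.1, hr.2.2.trans ht.2⟩

/-! ### The random variables `A_{i,j}` and `X_k` -/

section Coding

variable {h : ℕ} {𝒜 : Pair h → Type*} {𝒳 : Fin h → Type*}

/-- The sample space of one joint symbol `(A_{1,2}, …, A_{h-1,h}, X_1, …, X_h)`. -/
abbrev Sample (𝒜 : Pair h → Type*) (𝒳 : Fin h → Type*) : Type _ := (∀ s, 𝒜 s) × (∀ k, 𝒳 k)

/-- The random variable `A_s`. -/
def rvA (s : Pair h) (ω : Sample 𝒜 𝒳) : 𝒜 s := ω.1 s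

/-- The random vector `A_T = (A_s)_{s ∈ T}`. -/
def rvAOn (T : Finset (Pair h)) (ω : Sample 𝒜 𝒳) : ∀ s : T, 𝒜 s := fun s => ω.1 s

/-- The random vector of all the `A_s`. -/
def rvAll (ω : Sample 𝒜 𝒳) : ∀ s, 𝒜 s := ω.1

/-- The action vector `(X_1, …, X_h)`. -/
def rvX (ω : Sample 𝒜 𝒳) : ∀ k, 𝒳 k := ω.2

/-- The action `X_k` of node `k`. -/
def rvXAt (k : Fin h) (ω : Sample 𝒜 𝒳) : 𝒳 k := ω.2 k

/-- For every `s`, given `A_{Φ(s)}` the variable `A_s` is independent of the variables `A_r` with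
`r` unrelated to `s`. -/
def LayeredMarkov [∀ s, Fintype (𝒜 s)] [∀ k, Fintype (𝒳 k)] (Q : Sample 𝒜 𝒳 → ℝ) : Prop :=
  ∀ s, MarkovChain Q (rvA s) (rvAOn (phi s)) (rvAOn (unrelated s))

/-! ### The random codebooks -/

/-- The number of integers in `[1, 2 ^ (n μ)]`. -/
noncomputable def numIdx (n : ℕ) (μ : ℝ) : ℕ := ⌊(2 : ℝ) ^ ((n : ℝ) * μ)⌋₊

/-- The index pairs `m_s^± = (m_s^+, m_s^-)`. -/
abbrev Idx (μp μm : Pair h → ℝ) (n : ℕ) (s : Pair h) : Type :=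
  Fin (numIdx n (μp s)) × Fin (numIdx n (μm s))

/-- A realization of all the `A`-codebooks of block length `n`: a codeword of length `n` over the
alphabet of `A_s` for every `s` and every index tuple `m_{Φ̄(s)}^±`. -/
abbrev Codebook (𝒜 : Pair h → Type*) (μp μm : Pair h → ℝ) (n : ℕ) : Type _ :=
  (s : Pair h) → ((r : phiBar s) → Idx μp μm n r) → Fin n → 𝒜 s

variable {μp μm : Pair h → ℝ} {n : ℕ}

/-- The vector of the `t`-th symbols of the codewords `A^n(m^±)` chosen by the index tuple `m^±`. -/
def codeSymbol (c : Codebook 𝒜 μp μm n) (m : ∀ s, Idx μp μm n s) (t : Fin n) : ∀ s, 𝒜 s :=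
  fun s => c s (fun r => m r) t

variable [∀ s, Fintype (𝒜 s)] [∀ k, Fintype (𝒳 k)]

/-- The probability that the layered random construction yields the codebooks `c`: the codeword
with index `m_{Φ̄(s)}^±` is drawn from `Q_{A_s | A_{Φ(s)}}`, symbol by symbol, given the codewords
with indices `m_{Φ̄(r)}^±`, `r ∈ Φ(s)`, that were drawn before. -/
noncomputable def codebookProb (Q : Sample 𝒜 𝒳 → ℝ) (c : Codebook 𝒜 μp μm n) : ℝ :=
  ∏ s, ∏ m : (r : phiBar s) → Idx μp μm n r, ∏ t,
    cond Q (rvA s) (rvAOn (phi s)) (c s m t)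
      (fun r => c r (Finset.restrict₂ (phiBar_subset r.2) m) t)

/-- The expectation of `D` over the random codebooks. -/
noncomputable def expect (Q : Sample 𝒜 𝒳 → ℝ) (D : Codebook 𝒜 μp μm n → EReal) : EReal :=
  ∑ c, (codebookProb Q c : EReal) * D c

/-- The memoryless channel `Q_{f | A}^{⊗ n}(y | A^n(m^±))`. -/
noncomputable def channel {β : Type*} (Q : Sample 𝒜 𝒳 → ℝ) (f : Sample 𝒜 𝒳 → β)
    (c : Codebook 𝒜 μp μm n) (m : ∀ s, Idx μp μm n s) (y : Fin n → β) : ℝ :=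
  ∏ t, cond Q f rvAll (y t) (codeSymbol c m t)

/-- The pmf of the channel output for given codebooks when `m^±` is uniform. -/
noncomputable def outPmf {β : Type*} (Q : Sample 𝒜 𝒳 → ℝ) (f : Sample 𝒜 𝒳 → β)
    (c : Codebook 𝒜 μp μm n) (y : Fin n → β) : ℝ :=
  (∑ m, channel Q f c m y) / ∏ s, ((numIdx n (μp s) : ℝ) * numIdx n (μm s))

/-- The conditional pmf of the channel output given `m^-`, when `m^+` is uniform. -/
noncomputable def outPmfGiven {β : Type*} (Q : Sample 𝒜 𝒳 → ℝ) (f : Sample 𝒜 𝒳 → β)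
    (c : Codebook 𝒜 μp μm n) (mm : ∀ s, Fin (numIdx n (μm s))) (y : Fin n → β) : ℝ :=
  (∑ mp : ∀ s, Fin (numIdx n (μp s)), channel Q f c (fun s => (mp s, mm s)) y) /
    ∏ s, (numIdx n (μp s) : ℝ)

/-- The i.i.d. pmf `Q_f^{⊗ n}`. -/
noncomputable def iidPmf {β : Type*} (Q : Sample 𝒜 𝒳 → ℝ) (f : Sample 𝒜 𝒳 → β) (n : ℕ)
    (y : Fin n → β) : ℝ :=
  ∏ t, law Q f (y t)

/-- `E[D(Q̂_{X̂_1^n ⋯ X̂_h^n} ‖ Q_{X_1 ⋯ X_h}^{⊗ n})]`. -/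
noncomputable def expOutputDiv (Q : Sample 𝒜 𝒳 → ℝ) (μp μm : Pair h → ℝ) (n : ℕ) : EReal :=
  expect Q fun c : Codebook 𝒜 μp μm n => klDiv (outPmf Q rvX c) (iidPmf Q rvX n)

/-- The average over `m^-` of `E[D(Q̂_{X̂_k^n | M^- = m^-} ‖ Q̂_{X̂_k^n})]`. -/
noncomputable def expDependence (Q : Sample 𝒜 𝒳 → ℝ) (k : Fin h) (μp μm : Pair h → ℝ)
    (n : ℕ) : EReal :=
  ∑ mm : ∀ s, Fin (numIdx n (μm s)),
    (expect Q fun c : Codebook 𝒜 μp μm n =>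
        klDiv (outPmfGiven Q (rvXAt k) c mm) (outPmf Q (rvXAt k) c)) /
      ((∏ s, (numIdx n (μm s) : ℝ) : ℝ) : EReal)

end Coding

end LineCoord

open LineCoord

/-! Both parts rest on one soft-covering bound for superposition codebooks. The expected divergence
of the output from the memoryless law is the expectation of log Z, with Z the likelihood ratio of
the output pmf to the i.i.d. pmf, when the output comes from the word of a uniform index tuple k. By
concavity of the logarithm, Z may be replaced by its conditional mean given the word of k.

That mean is an average over a second tuple k'. If T is the set of pairs where k and k' differ, the
two words have common codewords exactly in the layers outside J_T and are conditionally independent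
in the rest. The Markov hypothesis makes the law of A factor along the layers. Averaging the channel
over the layers in J_T therefore leaves the channel from A_{J_T^c}, and k' contributes the density
ratio of X and A_{J_T^c} (`sum_codebookProb_two_words`, `sum_codebookProb_mul_channel`). If (1,h) is
in T nothing is shared and the ratio is at most 1; these k' account for the summand 1. The fraction
of tuples with a given T is at most the product of the inverse index-set sizes over T^c.

It remains to bound the mean of log(1 + Σ_T w_T ratio_T). The inequality log(1+x) ≤ x^θ/θ turns it
into a sum of θ-th moments, which are n-th powers of one-letter moments. At θ = 0 the logarithmic
derivative of such a moment is the mutual information times log 2. Hence the strict rate conditions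
make every term exponentially small for a small θ (`sum_codebookProb_mul_divergence_le`,
`eventually_infoMoment_lt`).

For (1) the bound is applied to all indices. For (2) it is applied with m^- fixed, so that only the
rates μ^+ count. Replacing the i.i.d. pmf by the average over m^- of the conditional output pmfs
only lowers the mean divergence (`sum_realDiv_average_le`). -/

namespace LineCoord

/-! ### Laws and conditional laws on a finite sample space -/

section Laws

variable {Ω β γ δ ε : Type*} [Fintype Ω] {Q : Ω → ℝ}

open Classical in
theorem law_eq_sum_ite (Q : Ω → ℝ) (f : Ω → β) (b : β) :
    law Q f b = ∑ ω, if f ω = b then Q ω else 0 := by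
  unfold law
  rw [Finset.sum_filter]

theorem law_nonneg (hQ : ∀ ω, 0 ≤ Q ω) (f : Ω → β) (b : β) : 0 ≤ law Q f b :=
  Finset.sum_nonneg fun ω _ => hQ ω

theorem law_mono (hQ : ∀ ω, 0 ≤ Q ω) {f : Ω → β} {g : Ω → γ} {b : β} {c : γ}
    (hfg : ∀ ω, f ω = b → g ω = c) : law Q f b ≤ law Q g c := by
  classical
  simp only [law_eq_sum_ite]
  refine Finset.sum_le_sum fun ω _ => ?_
  by_cases hf : f ω = b
  · rw [if_pos hf, if_pos (hfg ω hf)]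
  · rw [if_neg hf]
    split_ifs
    exacts [hQ ω, le_rfl]

theorem law_congr_event {f : Ω → β} {g : Ω → γ} {b : β} {c : γ}
    (hfg : ∀ ω, f ω = b ↔ g ω = c) : law Q f b = law Q g c := by
  classical
  simp only [law_eq_sum_ite, hfg]

theorem law_eq_zero_of_imp (hQ : ∀ ω, 0 ≤ Q ω) {f : Ω → β} {g : Ω → γ} {b : β} {c : γ}
    (hfg : ∀ ω, f ω = b → g ω = c) (h0 : law Q g c = 0) : law Q f b = 0 :=
  le_antisymm (h0 ▸ law_mono hQ hfg) (law_nonneg hQ f b)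

theorem le_law (hQ : ∀ ω, 0 ≤ Q ω) (f : Ω → β) (ω : Ω) : Q ω ≤ law Q f (f ω) := by
  classical
  unfold law
  exact Finset.single_le_sum (f := Q) (fun i _ => hQ i) (by simp)

/-- Expectations can be computed from the law. -/
theorem sum_mul_comp [Fintype β] (f : Ω → β) (g : β → ℝ) :
    ∑ ω, Q ω * g (f ω) = ∑ b, law Q f b * g b := by
  classical
  simp only [law_eq_sum_ite, Finset.sum_mul]
  rw [Finset.sum_comm]
  refine Finset.sum_congr rfl fun ω _ => ?_
  simp [ite_mul]

theorem sum_law [Fintype β] (f : Ω → β) : ∑ b, law Q f b = ∑ ω, Q ω := by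
  simpa using (sum_mul_comp (Q := Q) f fun _ => (1 : ℝ)).symm

theorem sum_law_pair [Fintype β] (f : Ω → β) (g : Ω → γ) (c : γ) :
    ∑ b, law Q (fun ω => (f ω, g ω)) (b, c) = law Q g c := by
  classical
  simp only [law_eq_sum_ite]
  rw [Finset.sum_comm]
  refine Finset.sum_congr rfl fun ω _ => ?_
  by_cases hc : g ω = c
  · simp [hc]
  · simp [hc]

theorem cond_nonneg (hQ : ∀ ω, 0 ≤ Q ω) (f : Ω → β) (g : Ω → γ) (b : β) (c : γ) :
    0 ≤ cond Q f g b c :=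
  div_nonneg (law_nonneg hQ _ _) (law_nonneg hQ _ _)

theorem sum_cond [Fintype β] (f : Ω → β) (g : Ω → γ) {c : γ} (hc : law Q g c ≠ 0) :
    ∑ b, cond Q f g b c = 1 := by
  unfold cond
  rw [← Finset.sum_div, sum_law_pair, div_self hc]

/-- The convention that `cond` is `0` on null events does no harm here: a null conditioning event
makes the joint law zero as well. -/
theorem cond_mul_law (hQ : ∀ ω, 0 ≤ Q ω) (f : Ω → β) (g : Ω → γ) (b : β) (c : γ) :
    cond Q f g b c * law Q g c = law Q (fun ω => (f ω, g ω)) (b, c) := by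
  unfold cond
  by_cases hc : law Q g c = 0
  · rw [hc, mul_zero, law_eq_zero_of_imp hQ _ hc]
    intro ω hω
    exact (Prod.mk.inj hω).2
  · exact div_mul_cancel₀ _ hc

theorem cond_eq_zero_of_law (hQ : ∀ ω, 0 ≤ Q ω) (f : Ω → β) (g : Ω → γ) {b : β} (c : γ)
    (hb : law Q f b = 0) : cond Q f g b c = 0 := by
  unfold cond
  rw [law_eq_zero_of_imp hQ (fun ω hω => (Prod.mk.inj hω).1) hb, zero_div]

theorem law_pair_map [Fintype γ] [DecidableEq ε] (p : Ω → β) (g : Ω → γ) (φ : γ → ε) (b : β)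
    (e : ε) : law Q (fun ω => (p ω, φ (g ω))) (b, e) =
      ∑ c, if φ c = e then law Q (fun ω => (p ω, g ω)) (b, c) else 0 := by
  classical
  simp only [law_eq_sum_ite, ← Finset.sum_filter (fun c => φ c = e)]
  rw [Finset.sum_comm]
  refine Finset.sum_congr rfl fun ω _ => ?_
  by_cases hp : p ω = b
  · simp [hp, Finset.sum_ite_eq]
  · simp [hp]

/-- A Markov chain remains one when its last variable is replaced by a function of it. -/
theorem MarkovChain.map [Fintype γ] {f : Ω → β} {k : Ω → δ} {g : Ω → γ}
    (hM : MarkovChain Q f k g) (φ : γ → ε) : MarkovChain Q f k (fun ω => φ (g ω)) := by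
  classical
  intro b d e
  have h1 : law Q (fun ω => (f ω, k ω, φ (g ω))) (b, d, e) =
      ∑ c, if φ c = e then law Q (fun ω => (f ω, k ω, g ω)) (b, d, c) else 0 := by
    rw [law_congr_event (g := fun ω => ((f ω, k ω), φ (g ω))) (c := ((b, d), e))
      (by intro ω; simp [and_assoc]), law_pair_map]
    refine Finset.sum_congr rfl fun c _ => ?_
    rw [law_congr_event (g := fun ω => (f ω, k ω, g ω)) (c := (b, d, c))
      (by intro ω; simp [and_assoc])]
  rw [h1, law_pair_map k g, Finset.sum_mul, Finset.mul_sum]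
  refine Finset.sum_congr rfl fun c _ => ?_
  split_ifs
  · exact hM b d c
  · simp

end Laws

/-! ### Marginals of Bayesian networks on ancestral sets -/

section BayesNet

variable {N : Type*} [Fintype N] [DecidableEq N] {α : N → Type*} [∀ v, Fintype (α v)]

open Classical in
/-- In a Bayesian network with nodes `N`, parents `pa` and kernels `f`, the marginal on an ancestral
set of nodes is the product of its kernels. A kernel need only be normalized where none of the
kernels at the parents vanishes. -/
theorem sum_prod_kernel_eq (pa : N → Set N) (rank : N → ℕ)
    (hrank : ∀ v, ∀ u ∈ pa v, rank u < rank v) (f : N → (∀ v, α v) → ℝ)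
    (hloc : ∀ v x y, x v = y v → (∀ u ∈ pa v, x u = y u) → f v x = f v y)
    (hnorm : ∀ v x, ∑ b, f v (Function.update x v b) = 1 ∨ ∃ u ∈ pa v, f u x = 0)
    (V : Finset N) (hV : ∀ v ∈ V, ∀ u ∈ pa v, u ∈ V) (x₀ : ∀ v, α v) :
    ∑ x : ∀ v, α v, (if ∀ v ∈ V, x v = x₀ v then ∏ v, f v x else 0) = ∏ v ∈ V, f v x₀ := by
  -- The induction adds to `V` a missing node of minimal rank. Its parents already lie in `V`, so
  -- the enlarged set is ancestral. The configuration `x₀` is generalized because the value at the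
  -- new node is then summed out.
  induction hk : Vᶜ.card generalizing V x₀ with
  | zero =>
    have hVu : V = Finset.univ := by
      rw [Finset.card_eq_zero] at hk
      simpa using hk
    subst hVu
    have : ∀ x : ∀ v, α v, (∀ v ∈ Finset.univ, x v = x₀ v) ↔ x = x₀ := fun x =>
      ⟨fun hx => funext fun v => hx v (Finset.mem_univ v), fun hx v _ => hx ▸ rfl⟩
    simp only [this]
    simp
  | succ k ih =>
    have hne : Vᶜ.Nonempty := Finset.card_pos.mp (by omega)
    obtain ⟨v, hv, hmin⟩ := Finset.exists_min_image Vᶜ rank hne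
    have hvV : v ∉ V := Finset.mem_compl.mp hv
    have hpa : ∀ u ∈ pa v, u ∈ V := by
      intro u hu
      by_contra huV
      have := hmin u (Finset.mem_compl.mpr huV)
      have := hrank v u hu
      omega
    have hV' : ∀ w ∈ insert v V, ∀ u ∈ pa w, u ∈ insert v V := by
      intro w hw u hu
      rcases Finset.mem_insert.mp hw with rfl | hw
      · exact Finset.mem_insert_of_mem (hpa u hu)
      · exact Finset.mem_insert_of_mem (hV w hw u hu)
    have hcard : (insert v V)ᶜ.card = k := by
      rw [Finset.card_compl, Finset.card_insert_of_notMem hvV]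
      rw [Finset.card_compl] at hk
      omega
    have hvne : ∀ u ∈ V, u ≠ v := fun u hu huv => hvV (huv ▸ hu)
    have hvpa : v ∉ pa v := fun h => lt_irrefl _ (hrank v v h)
    have hstep : ∑ x : ∀ v, α v, (if ∀ v ∈ V, x v = x₀ v then ∏ v, f v x else 0) =
        ∑ b, ∑ x : ∀ v, α v, (if ∀ u ∈ insert v V, x u = Function.update x₀ v b u
          then ∏ v, f v x else 0) := by
      rw [Finset.sum_comm]
      refine Finset.sum_congr rfl fun x _ => ?_
      have : ∀ b, (∀ u ∈ insert v V, x u = Function.update x₀ v b u) ↔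
          (x v = b ∧ ∀ u ∈ V, x u = x₀ u) := by
        intro b
        rw [Finset.forall_mem_insert, Function.update_self]
        refine and_congr_right fun _ => forall₂_congr fun u hu => ?_
        rw [Function.update_of_ne (hvne u hu)]
      simp only [this]
      by_cases hx : ∀ u ∈ V, x u = x₀ u
      · rw [if_pos hx, Finset.sum_eq_single (x v), if_pos ⟨rfl, hx⟩]
        · intro b _ hb
          exact if_neg fun hc => hb hc.1.symm
        · simp
      · rw [if_neg hx, Finset.sum_eq_zero]
        intro b _
        exact if_neg fun hc => hx hc.2
    rw [hstep]
    refine (Finset.sum_congr rfl fun b _ => ih _ hV' _ hcard).trans ?_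
    simp only [Finset.prod_insert hvV]
    have hold : ∀ b, ∏ u ∈ V, f u (Function.update x₀ v b) = ∏ u ∈ V, f u x₀ := by
      intro b
      refine Finset.prod_congr rfl fun u hu => hloc u _ _ ?_ ?_
      · exact Function.update_of_ne (hvne u hu) _ _
      · intro w hw
        exact Function.update_of_ne (hvne w (hV u hu w hw)) _ _
    simp only [hold, ← Finset.sum_mul]
    -- Either the new kernel sums to 1, or a kernel at a parent vanishes. Parents belong to `V`, so
    -- in the second case both sides are zero.
    rcases hnorm v x₀ with h1 | ⟨u, hu, h0⟩
    · rw [h1, one_mul]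
    · rw [Finset.prod_eq_zero (hpa u hu) h0, mul_zero]

end BayesNet

/-! ### Factorization of the law of the `A_s` along the layers -/

section Factorization

variable {h : ℕ} {𝒜 : Pair h → Type*} {𝒳 : Fin h → Type*}

theorem mem_phiBar_trans {r s t : Pair h} (hr : r ∈ phiBar s) (ht : t ∈ phiBar r) :
    t ∈ phiBar s := by
  simp only [phiBar, Finset.mem_filter, Finset.mem_univ, true_and] at *
  exact ⟨ht.1.trans hr.1, hr.2.trans ht.2⟩

theorem topPair_mem_phiBar (hh : 2 ≤ h) (s : Pair h) : topPair hh ∈ phiBar s := by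
  simp only [phiBar, topPair, Finset.mem_filter, Finset.mem_univ, true_and]
  refine ⟨Fin.mk_le_of_le_val (Nat.zero_le _), Fin.le_def.mpr ?_⟩
  have := s.1.2.2
  simp only
  omega

/-- The number of nodes outside the interval of a pair; it is smaller on the pairs in `Φ(s)`. -/
def depth (s : Pair h) : ℕ := s.1.1 + (h - s.1.2)

theorem depth_lt {r s : Pair h} (hr : r ∈ phi s) : depth r < depth s := by
  simp only [phi, phiBar, Finset.mem_erase, Finset.mem_filter, Finset.mem_univ, true_and] at hr
  obtain ⟨hne, h1, h2⟩ := hr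
  have h1' := Fin.le_def.mp h1
  have h2' := Fin.le_def.mp h2
  have hr2 := r.1.2.2
  have hs2 := s.1.2.2
  unfold depth
  by_contra hcon
  apply hne
  apply Subtype.ext
  apply Prod.ext
  · apply Fin.ext; omega
  · apply Fin.ext; omega

theorem rvAOn_eq_iff {U : Finset (Pair h)} {a : ∀ s, 𝒜 s} {ω : Sample 𝒜 𝒳} :
    rvAOn U ω = (fun s : U => a s) ↔ ∀ s ∈ U, ω.1 s = a s := by
  constructor
  · intro hω s hs
    exact congrFun hω ⟨s, hs⟩
  · intro hω
    funext s
    exact hω s s.2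

variable [∀ s, Fintype (𝒜 s)] [∀ k, Fintype (𝒳 k)] {Q : Sample 𝒜 𝒳 → ℝ}

/-- The kernel `Q_{A_s | A_{Φ(s)}}` as a function of the vector of all symbols. -/
noncomputable def layerKernel (Q : Sample 𝒜 𝒳 → ℝ) (s : Pair h) (a : ∀ s, 𝒜 s) : ℝ :=
  cond Q (rvA s) (rvAOn (phi s)) (a s) (fun r => a r)

/-- The law of `A_U` factorizes for every ancestral `U`. -/
theorem law_rvAOn_eq_prod (hQ : Q ∈ stdSimplex ℝ (Sample 𝒜 𝒳)) (hA : LayeredMarkov Q)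
    (U : Finset (Pair h)) (hU : ∀ s ∈ U, phiBar s ⊆ U) (a : ∀ s, 𝒜 s) :
    law Q (rvAOn U) (fun s => a s) = ∏ s ∈ U, layerKernel Q s a := by
  classical
  induction hk : U.card generalizing U with
  | zero =>
    obtain rfl := Finset.card_eq_zero.mp hk
    rw [Finset.prod_empty, ← hQ.2, law_eq_sum_ite]
    refine Finset.sum_congr rfl fun ω _ => if_pos ?_
    rw [rvAOn_eq_iff]
    simp
  | succ k ih =>
    have hne : U.Nonempty := Finset.card_pos.mp (by omega)
    -- A deepest pair lies above no other pair of `U`. Removing it leaves an ancestral set, and what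
    -- remains outside `phi s` is unrelated to `s`, so the Markov hypothesis applies.
    obtain ⟨s, hs, hmax⟩ := Finset.exists_max_image U depth hne
    have hU' : ∀ r ∈ U.erase s, phiBar r ⊆ U.erase s := by
      intro r hr t ht
      obtain ⟨hrs, hr⟩ := Finset.mem_erase.mp hr
      refine Finset.mem_erase.mpr ⟨?_, hU r hr ht⟩
      rintro rfl
      have := depth_lt (Finset.mem_erase.mpr ⟨hrs.symm, ht⟩)
      have := hmax r (Finset.mem_of_mem_erase hr)
      omega
    rw [← Finset.mul_prod_erase U _ hs, ← ih _ hU' (by rw [Finset.card_erase_of_mem hs]; omega)]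
    have hphi : phi s ⊆ U.erase s := fun r hr =>
      Finset.mem_erase.mpr ⟨(Finset.mem_erase.mp hr).1, hU s hs (Finset.mem_erase.mp hr).2⟩
    have hsub : U.erase s \ phi s ⊆ unrelated s := by
      intro r hr
      obtain ⟨hr, hrphi⟩ := Finset.mem_sdiff.mp hr
      have hrs := (Finset.mem_erase.mp hr).1
      simp only [unrelated, Finset.mem_filter, Finset.mem_univ, true_and]
      refine ⟨fun hc => hrphi (Finset.mem_erase.mpr ⟨hrs, hc⟩), fun hc => ?_⟩
      exact (Finset.mem_erase.mp (hU' r hr hc)).1 rfl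
    have hM := (hA s).map (Finset.restrict₂ (π := 𝒜) hsub) (a s) (fun r => a r) (fun r => a r)
    have hcover : ∀ ω : Sample 𝒜 𝒳,
        ((∀ r ∈ phi s, ω.1 r = a r) ∧ ∀ r ∈ U.erase s \ phi s, ω.1 r = a r) ↔
          ∀ r ∈ U.erase s, ω.1 r = a r := by
      intro ω
      refine ⟨fun hω r hr => ?_, fun hω => ⟨fun r hr => hω r (hphi hr), fun r hr =>
        hω r (Finset.mem_sdiff.mp hr).1⟩⟩
      by_cases hrp : r ∈ phi s
      · exact hω.1 r hrp
      · exact hω.2 r (Finset.mem_sdiff.mpr ⟨hr, hrp⟩)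
    have hres : ∀ ω : Sample 𝒜 𝒳, Finset.restrict₂ (π := 𝒜) hsub (rvAOn (unrelated s) ω) =
        rvAOn (U.erase s \ phi s) ω := fun ω => rfl
    have hall : ∀ ω : Sample 𝒜 𝒳, (∀ r ∈ U, ω.1 r = a r) ↔
        ω.1 s = a s ∧ ∀ r ∈ U.erase s, ω.1 r = a r := by
      intro ω
      conv_lhs => rw [← Finset.insert_erase hs]
      rw [Finset.forall_mem_insert]
    have e1 : law Q (fun ω => (rvA s ω, rvAOn (phi s) ω,
        Finset.restrict₂ (π := 𝒜) hsub (rvAOn (unrelated s) ω))) (a s, fun r => a r, fun r => a r) =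
        law Q (rvAOn U) (fun s => a s) := by
      refine law_congr_event fun ω => ?_
      simp only [Prod.mk.injEq, hres, rvAOn_eq_iff]
      rw [hcover, hall]
      rfl
    have e2 : law Q (fun ω => (rvAOn (phi s) ω,
        Finset.restrict₂ (π := 𝒜) hsub (rvAOn (unrelated s) ω))) (fun r => a r, fun r => a r) =
        law Q (rvAOn (U.erase s)) (fun s => a s) := by
      refine law_congr_event fun ω => ?_
      simp only [Prod.mk.injEq, hres, rvAOn_eq_iff]
      rw [hcover]
    rw [e1, e2] at hM
    unfold layerKernel cond
    -- On a null context the kernel is `0` by convention, and the law of the larger vector `A_U` is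
    -- zero too.
    by_cases h0 : law Q (rvAOn (phi s)) (fun r => a r) = 0
    · rw [h0, div_zero, zero_mul]
      refine law_eq_zero_of_imp hQ.1 (fun ω hω => ?_) h0
      rw [rvAOn_eq_iff] at hω ⊢
      exact fun r hr => hω r (Finset.mem_of_mem_erase (hphi hr))
    · field_simp
      linarith

theorem law_rvAll_eq_prod (hQ : Q ∈ stdSimplex ℝ (Sample 𝒜 𝒳)) (hA : LayeredMarkov Q)
    (a : ∀ s, 𝒜 s) : law Q rvAll a = ∏ s, layerKernel Q s a := by
  rw [← law_rvAOn_eq_prod hQ hA Finset.univ (fun _ _ => Finset.subset_univ _)]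
  refine law_congr_event fun ω => ?_
  rw [rvAOn_eq_iff]
  exact ⟨fun hω s _ => hω ▸ rfl, fun hω => funext fun s => hω s (Finset.mem_univ s)⟩

/-- A layer kernel whose context is null has a vanishing kernel above it. -/
theorem exists_layerKernel_eq_zero (hQ : Q ∈ stdSimplex ℝ (Sample 𝒜 𝒳)) (hA : LayeredMarkov Q)
    {s : Pair h} {a : ∀ s, 𝒜 s} (h0 : law Q (rvAOn (phi s)) (fun r => a r) = 0) :
    ∃ r ∈ phi s, layerKernel Q r a = 0 := by
  rw [law_rvAOn_eq_prod hQ hA (phi s)] at h0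
  · exact Finset.prod_eq_zero_iff.mp h0
  · intro r hr t ht
    refine Finset.mem_erase.mpr ⟨?_, phiBar_subset hr ht⟩
    rintro rfl
    have hne := (Finset.mem_erase.mp hr).1
    have := depth_lt hr
    have := depth_lt (Finset.mem_erase.mpr ⟨hne.symm, ht⟩)
    omega

theorem mem_jSet_compl {S : Finset (Pair h)} {s : Pair h} :
    s ∈ (jSet S)ᶜ ↔ ∀ r ∈ phiBar s, r ∉ S := by
  simp only [jSet, Finset.mem_compl, Finset.mem_filter, Finset.mem_univ, true_and,
    Finset.not_nonempty_iff_eq_empty, Finset.eq_empty_iff_forall_notMem, Finset.mem_inter, not_and]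

theorem jSet_compl_ancestral (S : Finset (Pair h)) : ∀ s ∈ (jSet S)ᶜ, phiBar s ⊆ (jSet S)ᶜ := by
  intro s hs r hr
  rw [mem_jSet_compl] at hs ⊢
  exact fun t ht => hs t (mem_phiBar_trans hr ht)

open Classical in
/-- Averaging the channel over the layers in `J_S`, given the other layers. -/
theorem sum_prod_layerKernel_mul_cond {β : Type*} (hQ : Q ∈ stdSimplex ℝ (Sample 𝒜 𝒳))
    (hA : LayeredMarkov Q) (f : Sample 𝒜 𝒳 → β) (S : Finset (Pair h)) (a : ∀ s, 𝒜 s) (b : β)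
    (ha : law Q (rvAOn (jSet S)ᶜ) (fun s => a s) ≠ 0) :
    ∑ a' : ∀ s, 𝒜 s, (if ∀ s ∈ (jSet S)ᶜ, a' s = a s then
      (∏ s ∈ jSet S, layerKernel Q s a') * cond Q f rvAll b a' else 0) =
      cond Q f (rvAOn (jSet S)ᶜ) b (fun s => a s) := by
  rw [show cond Q f (rvAOn (jSet S)ᶜ) b (fun s => a s) = _ / _ from rfl, eq_div_iff ha,
    Finset.sum_mul]
  have hr : law Q (fun ω => (f ω, rvAOn (jSet S)ᶜ ω)) (b, fun s => a s) =
      ∑ a' : ∀ s, 𝒜 s, if ∀ s ∈ (jSet S)ᶜ, a' s = a s then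
        law Q (fun ω => (f ω, rvAll ω)) (b, a') else 0 := by
    simp only [law_eq_sum_ite,
      ← Finset.sum_filter (fun a' : ∀ s, 𝒜 s => ∀ s ∈ (jSet S)ᶜ, a' s = a s)]
    rw [Finset.sum_comm]
    refine Finset.sum_congr rfl fun ω _ => ?_
    rw [Finset.sum_filter]
    simp only [Prod.mk.injEq, rvAOn_eq_iff]
    by_cases hb : f ω = b
    · simp only [hb, true_and]
      rw [Finset.sum_eq_single ω.1]
      · simp [rvAll]
      · intro a' _ hne
        simp [rvAll, hne.symm]
      · simp
    · simp [hb]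
  rw [hr]
  refine Finset.sum_congr rfl fun a' _ => ?_
  split_ifs with hcons
  -- The kernels of an ancestral set read only coordinates inside it, where `a'` agrees with `a`.
  -- Their product thus does not depend on `a'` and is the conditioning probability.
  · have hlaw : law Q (rvAOn (jSet S)ᶜ) (fun s => a s) = ∏ s ∈ (jSet S)ᶜ, layerKernel Q s a' := by
      rw [← law_rvAOn_eq_prod hQ hA _ (jSet_compl_ancestral S)]
      congr 1
      funext s
      exact (hcons s s.2).symm
    have hfull : law Q rvAll a' =
        (∏ s ∈ jSet S, layerKernel Q s a') * ∏ s ∈ (jSet S)ᶜ, layerKernel Q s a' := by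
      rw [law_rvAll_eq_prod hQ hA, Finset.prod_mul_prod_compl]
    rw [← cond_mul_law hQ.1, hfull, hlaw]
    ring
  · simp

end Factorization

end LineCoord

/-! ### Joint law of two words of the random codebooks -/

namespace LineCoord

/-- Meant for the restrictions of two index tuples to `phiBar s`: a layer contributes one codeword
if they coincide and two otherwise. -/
theorem prod_ite_eq_or_eq {κ M : Type*} [Fintype κ] [DecidableEq κ] [CommMonoid M] (p q : κ)
    (g : κ → M) :
    ∏ k, (if k = p ∨ k = q then g k else 1) = g p * if p = q then 1 else g q := by
  by_cases hpq : p = q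
  · subst hpq
    simp
  · have : ∀ k, (if k = p ∨ k = q then g k else 1) =
        (if k = p then g k else 1) * (if k = q then g k else 1) := by
      intro k
      by_cases h1 : k = p
      · subst h1
        simp [hpq]
      · simp [h1]
    simp only [this, Finset.prod_mul_distrib, Finset.prod_ite_eq', Finset.mem_univ, if_true,
      if_neg hpq]

section CodebookLaw

variable {h : ℕ} {𝒜 : Pair h → Type*} {𝒳 : Fin h → Type*} {μp μm : Pair h → ℝ} {n : ℕ}

/-- The symbols of the codebooks, indexed by layer, index tuple and time. -/
abbrev CodeNode (μp μm : Pair h → ℝ) (n : ℕ) : Type :=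
  Σ s : Pair h, ((r : phiBar s) → Idx μp μm n r) × Fin n

/-- Codebooks as families of symbols. -/
def codebookEquiv (𝒜 : Pair h → Type*) (μp μm : Pair h → ℝ) (n : ℕ) :
    (∀ v : CodeNode μp μm n, 𝒜 v.1) ≃ Codebook 𝒜 μp μm n where
  toFun x s k t := x ⟨s, k, t⟩
  invFun c v := c v.1 v.2.1 v.2.2
  left_inv _ := rfl
  right_inv _ := rfl

/-- The symbol of layer `r` on which the symbol `v` is superimposed. -/
def parentNode (v : CodeNode μp μm n) (r : phi v.1) : CodeNode μp μm n :=
  ⟨r, Finset.restrict₂ (phiBar_subset r.2) v.2.1, v.2.2⟩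

/-- The pairs in which two index tuples differ. -/
def diffSet {K : Pair h → Type*} [∀ s, DecidableEq (K s)] (m m' : ∀ s, K s) : Finset (Pair h) :=
  Finset.univ.filter fun s => m s ≠ m' s

/-- This is where `jSet` comes from: the codeword of layer `s` is addressed by the indices in all of
`phiBar s`, so two tuples select the same one exactly when they agree there. -/
theorem mem_jSet_diffSet_compl {K : Pair h → Type*} [∀ s, DecidableEq (K s)] {m m' : ∀ s, K s}
    {s : Pair h} : s ∈ (jSet (diffSet m m'))ᶜ ↔
      (fun r : phiBar s => m r) = fun r : phiBar s => m' r := by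
  rw [mem_jSet_compl, funext_iff]
  simp [diffSet]

variable [∀ s, Fintype (𝒜 s)] [∀ k, Fintype (𝒳 k)] {Q : Sample 𝒜 𝒳 → ℝ}

/-- The conditional pmf of a codebook symbol given the symbols it is superimposed on. -/
noncomputable def nodeKernel (Q : Sample 𝒜 𝒳 → ℝ) (v : CodeNode μp μm n)
    (x : ∀ v : CodeNode μp μm n, 𝒜 v.1) : ℝ :=
  cond Q (rvA v.1) (rvAOn (phi v.1)) (x v) (fun r => x (parentNode v r))

theorem codebookProb_codebookEquiv (Q : Sample 𝒜 𝒳 → ℝ) (x : ∀ v : CodeNode μp μm n, 𝒜 v.1) :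
    codebookProb Q (codebookEquiv 𝒜 μp μm n x) = ∏ v, nodeKernel Q v x := by
  rw [Fintype.prod_sigma]
  refine Finset.prod_congr rfl fun s _ => ?_
  rw [Fintype.prod_prod_type]
  rfl

/-- Normalization can fail only on a null context, where `cond` is `0`. As `phi v.1` is ancestral,
the probability of the context is the product of the kernels above, so one of these must vanish. -/
theorem nodeKernel_normalized (hQ : Q ∈ stdSimplex ℝ (Sample 𝒜 𝒳)) (hA : LayeredMarkov Q)
    (v : CodeNode μp μm n) (x : ∀ v : CodeNode μp μm n, 𝒜 v.1) :
    ∑ b, nodeKernel Q v (Function.update x v b) = 1 ∨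
      ∃ u ∈ Set.range (parentNode v), nodeKernel Q u x = 0 := by
  have hne : ∀ r, parentNode v r ≠ v := by
    intro r hr
    have h1 := depth_lt r.2
    have h2 : (parentNode v r).1 = v.1 := by rw [hr]
    exact absurd (congrArg depth h2) h1.ne
  by_cases h0 : law Q (rvAOn (phi v.1)) (fun r => x (parentNode v r)) = 0
  · right
    obtain ⟨ω⟩ : Nonempty (Sample 𝒜 𝒳) := by
      by_contra hemp
      rw [not_nonempty_iff] at hemp
      have := hQ.2
      simp at this
    -- Only the symbols in `phi v.1` matter; `ω` supplies arbitrary values elsewhere.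
    let a : ∀ s, 𝒜 s := fun r => if hr : r ∈ phi v.1 then x (parentNode v ⟨r, hr⟩) else ω.1 r
    have ha : ∀ r : phi v.1, a r = x (parentNode v r) := fun r => dif_pos r.2
    have h0' : law Q (rvAOn (phi v.1)) (fun r => a r) = 0 := by
      rw [← h0]
      congr 1
      funext r
      exact ha r
    obtain ⟨r, hr, hr0⟩ := exists_layerKernel_eq_zero hQ hA h0'
    refine ⟨parentNode v ⟨r, hr⟩, ⟨_, rfl⟩, ?_⟩
    rw [← hr0]
    unfold nodeKernel layerKernel
    congr 1
    · exact (ha ⟨r, hr⟩).symm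
    · funext q
      have hq : (q : Pair h) ∈ phi v.1 := by
        have h1 := depth_lt q.2
        have h2 := depth_lt hr
        refine Finset.mem_erase.mpr ⟨?_, phiBar_subset hr (Finset.mem_of_mem_erase q.2)⟩
        intro hc
        rw [hc] at h1
        change depth v.1 < depth r at h1
        omega
      exact (ha ⟨q, hq⟩).symm
  · left
    rw [← sum_cond (rvA v.1) (rvAOn (phi v.1)) h0]
    refine Finset.sum_congr rfl fun b _ => ?_
    unfold nodeKernel
    rw [Function.update_self]
    congr 1
    funext r
    exact Function.update_of_ne (hne r) _ _

theorem nodeKernel_eq_layerKernel (x : ∀ v : CodeNode μp μm n, 𝒜 v.1) (m : ∀ s, Idx μp μm n s)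
    (a : Fin n → ∀ s, 𝒜 s) (hx : ∀ s t, x ⟨s, fun r => m r, t⟩ = a t s) (s : Pair h) (t : Fin n) :
    nodeKernel Q ⟨s, fun r => m r, t⟩ x = layerKernel Q s (a t) := by
  change cond Q _ _ (x ⟨s, fun r => m r, t⟩) (fun r : phi s => x ⟨r, fun q => m q, t⟩) = _
  simp only [hx]
  rfl

open Classical in
/-- A product over the codebook symbols of two words. -/
theorem prod_codeNode_two_words (m m' : ∀ s, Idx μp μm n s) (g : CodeNode μp μm n → ℝ) :
    (∏ v : CodeNode μp μm n, if v.2.1 = (fun r : phiBar v.1 => m r) ∨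
        v.2.1 = (fun r : phiBar v.1 => m' r) then g v else 1) =
      ∏ t, ((∏ s, g ⟨s, fun r => m r, t⟩) *
        ∏ s ∈ jSet (diffSet m m'), g ⟨s, fun r => m' r, t⟩) := by
  rw [Fintype.prod_sigma]
  have hs : ∀ s : Pair h, (∏ y : ((r : phiBar s) → Idx μp μm n r) × Fin n,
      if y.1 = (fun r : phiBar s => m r) ∨ y.1 = (fun r : phiBar s => m' r) then
        g ⟨s, y⟩ else 1) =
      ∏ t, (g ⟨s, fun r => m r, t⟩ *
        if s ∈ jSet (diffSet m m') then g ⟨s, fun r => m' r, t⟩ else 1) := by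
    intro s
    rw [Fintype.prod_prod_type]
    have : ∀ k : (r : phiBar s) → Idx μp μm n r, (∏ t : Fin n,
        if k = (fun r : phiBar s => m r) ∨ k = (fun r : phiBar s => m' r) then
          g ⟨s, k, t⟩ else 1) =
        if k = (fun r : phiBar s => m r) ∨ k = (fun r : phiBar s => m' r) then
          ∏ t : Fin n, g ⟨s, k, t⟩ else 1 := by
      intro k
      split_ifs <;> simp
    simp only [this]
    rw [prod_ite_eq_or_eq, Finset.prod_mul_distrib]
    congr 1
    by_cases hsJ : s ∈ jSet (diffSet m m')
    · have : ¬ (fun r : phiBar s => m r) = fun r : phiBar s => m' r := by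
        rw [← mem_jSet_diffSet_compl]
        simpa using hsJ
      rw [if_neg this]
      simp only [if_pos hsJ]
    · have : (fun r : phiBar s => m r) = fun r : phiBar s => m' r := by
        rw [← mem_jSet_diffSet_compl]
        simpa using hsJ
      rw [if_pos this]
      simp only [if_neg hsJ, Finset.prod_const_one]
  refine (Finset.prod_congr rfl fun s _ => hs s).trans ?_
  rw [Finset.prod_comm]
  refine Finset.prod_congr rfl fun t _ => ?_
  rw [Finset.prod_mul_distrib, Finset.prod_ite_mem, Finset.univ_inter]

open Classical in
/-- The joint law of two words of the random codebooks. -/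
theorem sum_codebookProb_two_words (hQ : Q ∈ stdSimplex ℝ (Sample 𝒜 𝒳)) (hA : LayeredMarkov Q)
    (m m' : ∀ s, Idx μp μm n s) (a a' : Fin n → ∀ s, 𝒜 s) :
    ∑ c : Codebook 𝒜 μp μm n,
      (if codeSymbol c m = a ∧ codeSymbol c m' = a' then codebookProb Q c else 0) =
    if ∀ t, ∀ s ∈ (jSet (diffSet m m'))ᶜ, a' t s = a t s then
      ∏ t, ((∏ s, layerKernel Q s (a t)) * ∏ s ∈ jSet (diffSet m m'), layerKernel Q s (a' t))
    else 0 := by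
  split_ifs with hcons
  -- One assignment of symbols realizes both words. The consistency condition `hcons` is needed
  -- exactly at the addresses common to both.
  · obtain ⟨x₀, hx, hx'⟩ : ∃ x₀ : ∀ v : CodeNode μp μm n, 𝒜 v.1,
        (∀ s t, x₀ ⟨s, fun r => m r, t⟩ = a t s) ∧ ∀ s t, x₀ ⟨s, fun r => m' r, t⟩ = a' t s := by
      refine ⟨fun v => if v.2.1 = (fun r : phiBar v.1 => m r) then a v.2.2 v.1 else a' v.2.2 v.1,
        fun s t => if_pos rfl, fun s t => ?_⟩
      by_cases hs : (fun r : phiBar s => m' r) = fun r : phiBar s => m r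
      · rw [hcons t s (mem_jSet_diffSet_compl.mpr hs.symm)]
        exact if_pos hs
      · exact if_neg hs
    -- The symbols used by the two words form an ancestral set of the codebook network, so their
    -- joint law is the product of the kernels in it.
    let V : Finset (CodeNode μp μm n) := Finset.univ.filter fun v =>
      v.2.1 = (fun r : phiBar v.1 => m r) ∨ v.2.1 = (fun r : phiBar v.1 => m' r)
    have hVmem : ∀ v : CodeNode μp μm n, v ∈ V ↔
        v.2.1 = (fun r : phiBar v.1 => m r) ∨ v.2.1 = (fun r : phiBar v.1 => m' r) := by
      intro v
      simp [V]
    have hV : ∀ v ∈ V, ∀ u ∈ Set.range (parentNode v), u ∈ V := by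
      rintro v hv _ ⟨r, rfl⟩
      rw [hVmem] at hv ⊢
      rcases hv with hv | hv
      · left
        simp only [parentNode, hv]
        rfl
      · right
        simp only [parentNode, hv]
        rfl
    have hnet := sum_prod_kernel_eq (fun v : CodeNode μp μm n => Set.range (parentNode v))
      (fun v => depth v.1) (by rintro v _ ⟨r, rfl⟩; exact depth_lt r.2) (nodeKernel Q)
      (by
        intro v x y hv hp
        unfold nodeKernel
        rw [hv]
        congr 1
        funext r
        exact hp _ ⟨r, rfl⟩)
      (nodeKernel_normalized hQ hA) V hV x₀
    rw [← Equiv.sum_comp (codebookEquiv 𝒜 μp μm n)]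
    have hiff : ∀ x : ∀ v : CodeNode μp μm n, 𝒜 v.1,
        (codeSymbol (codebookEquiv 𝒜 μp μm n x) m = a ∧
          codeSymbol (codebookEquiv 𝒜 μp μm n x) m' = a') ↔ ∀ v ∈ V, x v = x₀ v := by
      intro x
      constructor
      · rintro ⟨h1, h2⟩ ⟨s, k, t⟩ hv
        rcases (hVmem _).mp hv with hk | hk
        · simp only at hk
          subst hk
          rw [hx, ← h1]
          rfl
        · simp only at hk
          subst hk
          rw [hx', ← h2]
          rfl
      · intro hv
        constructor
        · funext t s
          rw [← hx]
          exact hv ⟨s, _, t⟩ ((hVmem _).mpr (Or.inl rfl))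
        · funext t s
          rw [← hx']
          exact hv ⟨s, _, t⟩ ((hVmem _).mpr (Or.inr rfl))
    simp only [codebookProb_codebookEquiv]
    have hL : (∑ x : ∀ v : CodeNode μp μm n, 𝒜 v.1,
        if codeSymbol (codebookEquiv 𝒜 μp μm n x) m = a ∧
          codeSymbol (codebookEquiv 𝒜 μp μm n x) m' = a' then ∏ v, nodeKernel Q v x else 0) =
        ∏ v ∈ V, nodeKernel Q v x₀ := by
      rw [← hnet]
      refine Finset.sum_congr rfl fun x _ => ?_
      by_cases hc : ∀ v ∈ V, x v = x₀ v
      · rw [if_pos hc, if_pos ((hiff x).mpr hc)]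
      · rw [if_neg hc, if_neg (fun hc' => hc ((hiff x).mp hc'))]
    rw [hL, Finset.prod_filter, prod_codeNode_two_words m m' fun v => nodeKernel Q v x₀]
    simp only [nodeKernel_eq_layerKernel x₀ m a hx, nodeKernel_eq_layerKernel x₀ m' a' hx']
  · refine Finset.sum_eq_zero fun c _ => if_neg ?_
    rintro ⟨rfl, rfl⟩
    apply hcons
    intro t s hs
    have := mem_jSet_diffSet_compl.mp hs
    simp only [codeSymbol]
    rw [this]

/-- The law of a word of the random codebooks. -/
theorem sum_codebookProb_mul_word (hQ : Q ∈ stdSimplex ℝ (Sample 𝒜 𝒳)) (hA : LayeredMarkov Q)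
    (m : ∀ s, Idx μp μm n s) (G : (Fin n → ∀ s, 𝒜 s) → ℝ) :
    ∑ c : Codebook 𝒜 μp μm n, codebookProb Q c * G (codeSymbol c m) =
      ∑ a : Fin n → ∀ s, 𝒜 s, (∏ t, law Q rvAll (a t)) * G a := by
  classical
  -- A single word is treated as a pair of identical words: no layer is resampled.
  have hJ : jSet (diffSet m m) = ∅ := by
    simp [jSet, diffSet]
  have key := fun a => sum_codebookProb_two_words hQ hA m m a a
  simp only [and_self, hJ, Finset.prod_empty, mul_one, implies_true, if_true,
    ← law_rvAll_eq_prod hQ hA] at key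
  simp only [← key, Finset.sum_mul]
  rw [Finset.sum_comm]
  refine Finset.sum_congr rfl fun c _ => ?_
  simp [ite_mul]

open Classical in
/-- The expected channel output of one word, weighted by a function of another word. -/
theorem sum_codebookProb_mul_channel {β : Type*} (hQ : Q ∈ stdSimplex ℝ (Sample 𝒜 𝒳))
    (hA : LayeredMarkov Q) (f : Sample 𝒜 𝒳 → β) (m m' : ∀ s, Idx μp μm n s)
    (G : (Fin n → ∀ s, 𝒜 s) → ℝ) (y : Fin n → β) :
    ∑ c : Codebook 𝒜 μp μm n, codebookProb Q c * (G (codeSymbol c m) * channel Q f c m' y) =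
      ∑ a : Fin n → ∀ s, 𝒜 s, (∏ t, law Q rvAll (a t)) *
        (G a * ∏ t, cond Q f (rvAOn (jSet (diffSet m m'))ᶜ) (y t) (fun s => a t s)) := by
  set J := jSet (diffSet m m') with hJ
  have h1 : ∀ c : Codebook 𝒜 μp μm n,
      codebookProb Q c * (G (codeSymbol c m) * channel Q f c m' y) =
      ∑ a : Fin n → ∀ s, 𝒜 s, ∑ a' : Fin n → ∀ s, 𝒜 s,
        (if codeSymbol c m = a ∧ codeSymbol c m' = a' then codebookProb Q c else 0) *
          (G a * ∏ t, cond Q f rvAll (y t) (a' t)) := by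
    intro c
    rw [Finset.sum_eq_single (codeSymbol c m), Finset.sum_eq_single (codeSymbol c m')]
    · simp [channel]
    · intro a' _ hne
      simp [hne.symm]
    · simp
    · intro a _ hne
      simp [hne.symm]
    · simp
  simp only [h1]
  rw [Finset.sum_comm]
  refine Finset.sum_congr rfl fun a _ => ?_
  rw [Finset.sum_comm]
  simp only [← Finset.sum_mul, sum_codebookProb_two_words hQ hA m m']
  rw [← hJ]
  have h2 : ∀ a' : Fin n → ∀ s, 𝒜 s,
      (if ∀ t, ∀ s ∈ Jᶜ, a' t s = a t s then
        ∏ t, ((∏ s, layerKernel Q s (a t)) * ∏ s ∈ J, layerKernel Q s (a' t)) else 0) *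
        (G a * ∏ t, cond Q f rvAll (y t) (a' t)) =
      (∏ t, law Q rvAll (a t)) * (G a * ∏ t, (if ∀ s ∈ Jᶜ, a' t s = a t s then
        (∏ s ∈ J, layerKernel Q s (a' t)) * cond Q f rvAll (y t) (a' t) else 0)) := by
    intro a'
    by_cases hc : ∀ t, ∀ s ∈ Jᶜ, a' t s = a t s
    · rw [if_pos hc]
      have : ∀ t, (if ∀ s ∈ Jᶜ, a' t s = a t s then
        (∏ s ∈ J, layerKernel Q s (a' t)) * cond Q f rvAll (y t) (a' t) else 0) =
        (∏ s ∈ J, layerKernel Q s (a' t)) * cond Q f rvAll (y t) (a' t) := fun t => if_pos (hc t)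
      simp only [this, Finset.prod_mul_distrib, law_rvAll_eq_prod hQ hA]
      ring
    · rw [if_neg hc]
      obtain ⟨t, ht⟩ := not_forall.mp hc
      rw [Finset.prod_eq_zero (i := t) (f := fun t => (if ∀ s ∈ Jᶜ, a' t s = a t s then
        (∏ s ∈ J, layerKernel Q s (a' t)) * cond Q f rvAll (y t) (a' t) else 0))
        (Finset.mem_univ t) (if_neg ht)]
      simp
  simp only [h2, ← Finset.mul_sum]
  -- Averaging out the layers of `J` requires a non-null context at each time. Null words carry
  -- weight zero and are set aside.
  by_cases h0 : ∏ t, law Q rvAll (a t) = 0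
  · rw [h0, zero_mul, zero_mul]
  · congr 2
    have h3 := (Finset.prod_univ_sum (fun _ : Fin n => (Finset.univ : Finset (∀ s, 𝒜 s)))
      (fun t α => if ∀ s ∈ Jᶜ, α s = a t s then
        (∏ s ∈ J, layerKernel Q s α) * cond Q f rvAll (y t) α else 0)).symm
    rw [Fintype.piFinset_univ] at h3
    rw [h3]
    refine Finset.prod_congr rfl fun t _ => ?_
    refine sum_prod_layerKernel_mul_cond hQ hA f _ (a t) (y t) fun hz => h0 ?_
    refine Finset.prod_eq_zero (Finset.mem_univ t) (law_eq_zero_of_imp hQ.1 (fun ω hω => ?_) hz)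
    rw [rvAOn_eq_iff]
    exact fun s _ => by rw [← hω]; rfl

end CodebookLaw

end LineCoord

namespace LineCoord

/-! ### Tilted moments of the information density -/

section Tilting

variable {Ω β γ : Type*} [Fintype Ω] {Q : Ω → ℝ}

/-- The information density ratio `P(f = b | g = c) / P(f = b)`. -/
noncomputable def infoRatio (Q : Ω → ℝ) (f : Ω → β) (g : Ω → γ) (b : β) (c : γ) : ℝ :=
  cond Q f g b c / law Q f b

/-- The `θ`-th moment of the information density ratio. -/
noncomputable def infoMoment (Q : Ω → ℝ) (f : Ω → β) (g : Ω → γ) (θ : ℝ) : ℝ :=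
  ∑ ω, Q ω * infoRatio Q f g (f ω) (g ω) ^ θ

theorem infoRatio_nonneg (hQ : ∀ ω, 0 ≤ Q ω) (f : Ω → β) (g : Ω → γ) (b : β) (c : γ) :
    0 ≤ infoRatio Q f g b c :=
  div_nonneg (cond_nonneg hQ f g b c) (law_nonneg hQ f b)

theorem infoRatio_pos (hQ : ∀ ω, 0 ≤ Q ω) (f : Ω → β) (g : Ω → γ) {ω : Ω} (hω : Q ω ≠ 0) :
    0 < infoRatio Q f g (f ω) (g ω) := by
  have hpos : 0 < Q ω := lt_of_le_of_ne (hQ ω) hω.symm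
  exact div_pos (div_pos (hpos.trans_le (le_law hQ (fun ω => (f ω, g ω)) ω))
    (hpos.trans_le (le_law hQ g ω))) (hpos.trans_le (le_law hQ f ω))

theorem infoMoment_nonneg (hQ : ∀ ω, 0 ≤ Q ω) (f : Ω → β) (g : Ω → γ) (θ : ℝ) :
    0 ≤ infoMoment Q f g θ :=
  Finset.sum_nonneg fun ω _ => mul_nonneg (hQ ω)
    (Real.rpow_nonneg (infoRatio_nonneg hQ f g _ _) θ)

theorem mutualInfo_eq_sum [Fintype β] [Fintype γ] (f : Ω → β) (g : Ω → γ) :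
    mutualInfo Q f g = ∑ ω, Q ω * Real.logb 2 (infoRatio Q f g (f ω) (g ω)) := by
  rw [sum_mul_comp (fun ω => (f ω, g ω)) fun p => Real.logb 2 (infoRatio Q f g p.1 p.2),
    Fintype.sum_prod_type]
  unfold mutualInfo infoRatio cond
  refine Finset.sum_congr rfl fun b _ => Finset.sum_congr rfl fun c _ => ?_
  rw [div_div, mul_comm (law Q g c)]

/-- For small `θ` the `θ`-th moment of the information density ratio is less than `2 ^ (θ R)`,
if `R` exceeds the mutual information. -/
theorem eventually_infoMoment_lt [Fintype β] [Fintype γ] (hQ : Q ∈ stdSimplex ℝ Ω) (f : Ω → β)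
    (g : Ω → γ) {R : ℝ} (hR : mutualInfo Q f g < R) :
    ∀ᶠ θ in 𝓝[>] (0 : ℝ), infoMoment Q f g θ < 2 ^ (θ * R) := by
  -- `F` vanishes at 0 with derivative `log 2 * (I - R) < 0`, so it is negative just to the right of
  -- 0. The exponential form makes each summand differentiable at 0; outcomes of probability zero,
  -- whose ratio may vanish, drop out.
  let F : ℝ → ℝ := fun θ =>
    ∑ ω, Q ω * Real.exp (θ * Real.log (infoRatio Q f g (f ω) (g ω))) -
      Real.exp (θ * (Real.log 2 * R))
  have hF : ∀ θ, F θ = infoMoment Q f g θ - 2 ^ (θ * R) := by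
    intro θ
    unfold F infoMoment
    congr 1
    · refine Finset.sum_congr rfl fun ω _ => ?_
      by_cases hω : Q ω = 0
      · rw [hω, zero_mul, zero_mul]
      · rw [Real.rpow_def_of_pos (infoRatio_pos hQ.1 f g hω), mul_comm θ]
    · rw [Real.rpow_def_of_pos two_pos]
      congr 1
      ring
  have hd : HasDerivAt F
      (∑ ω, Q ω * Real.log (infoRatio Q f g (f ω) (g ω)) - Real.log 2 * R) 0 := by
    have hexp : ∀ a : ℝ, HasDerivAt (fun θ : ℝ => Real.exp (θ * a)) a 0 := by
      intro a
      simpa using ((hasDerivAt_id (0 : ℝ)).mul_const a).exp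
    exact (HasDerivAt.fun_sum fun ω _ => (hexp _).const_mul (Q ω)).sub (hexp _)
  have hlog2 : 0 < Real.log 2 := Real.log_pos one_lt_two
  have hneg : ∑ ω, Q ω * Real.log (infoRatio Q f g (f ω) (g ω)) - Real.log 2 * R < 0 := by
    have : ∑ ω, Q ω * Real.log (infoRatio Q f g (f ω) (g ω)) = Real.log 2 * mutualInfo Q f g := by
      rw [mutualInfo_eq_sum, Finset.mul_sum]
      refine Finset.sum_congr rfl fun ω _ => ?_
      unfold Real.logb
      field_simp
    rw [this, ← mul_sub]
    exact mul_neg_of_pos_of_neg hlog2 (sub_neg.mpr hR)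
  have hF0 : F 0 = 0 := by
    simp [F, hQ.2]
  have hev := (hasDerivAt_iff_tendsto_slope.mp hd).eventually (gt_mem_nhds hneg)
  have hev' : ∀ᶠ θ in 𝓝[>] (0 : ℝ), slope F 0 θ < 0 :=
    hev.filter_mono (nhdsWithin_mono _ fun x hx => ne_of_gt hx)
  filter_upwards [hev', self_mem_nhdsWithin] with θ hθ hpos
  rw [slope_def_field, hF0, sub_zero, sub_zero, div_neg_iff] at hθ
  have hpos' : (0 : ℝ) < θ := hpos
  have : F θ < 0 := by
    rcases hθ with h | h
    · linarith [h.2]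
    · exact h.1
  rw [hF] at this
  linarith

/-- `log (1 + x) ≤ x ^ θ / θ` for `0 < θ ≤ 1`. -/
theorem log_one_add_le_rpow_div {x θ : ℝ} (hx : 0 ≤ x) (hθ : 0 < θ) (hθ1 : θ ≤ 1) :
    Real.log (1 + x) ≤ x ^ θ / θ := by
  rw [le_div_iff₀ hθ, mul_comm, ← Real.log_rpow (by linarith)]
  -- Subadditivity of `t ↦ t ^ θ` for `θ ≤ 1`; then `log u ≤ u - 1`.
  have h1 : (1 + x) ^ θ ≤ 1 + x ^ θ := by
    simpa using Real.rpow_add_le_add_rpow zero_le_one hx hθ.le hθ1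
  have h2 : 0 < (1 + x) ^ θ := Real.rpow_pos_of_pos (by linarith) θ
  have := Real.log_le_sub_one_of_pos h2
  linarith

/-- The bound for one summand extends to sums because `1 + a + b ≤ (1 + a) * (1 + b)` for
nonnegative `a`, `b`. -/
theorem log_one_add_sum_le {ι : Type*} (s : Finset ι) (x : ι → ℝ) (hx : ∀ i ∈ s, 0 ≤ x i) {θ : ℝ}
    (hθ : 0 < θ) (hθ1 : θ ≤ 1) :
    Real.log (1 + ∑ i ∈ s, x i) ≤ ∑ i ∈ s, x i ^ θ / θ := by
  classical
  induction s using Finset.induction_on with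
  | empty => simp
  | insert i s his ih =>
    rw [Finset.sum_insert his, Finset.sum_insert his]
    have hi := hx i (Finset.mem_insert_self i s)
    have hs : ∀ j ∈ s, 0 ≤ x j := fun j hj => hx j (Finset.mem_insert_of_mem hj)
    have hS := Finset.sum_nonneg hs
    calc Real.log (1 + (x i + ∑ j ∈ s, x j))
        ≤ Real.log ((1 + x i) * (1 + ∑ j ∈ s, x j)) := by
          refine Real.log_le_log (by linarith) ?_
          nlinarith [mul_nonneg hi hS]
      _ = Real.log (1 + x i) + Real.log (1 + ∑ j ∈ s, x j) :=
          Real.log_mul (by linarith) (by linarith)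
      _ ≤ _ := add_le_add (log_one_add_le_rpow_div hi hθ hθ1) (ih hs)

end Tilting

/-! ### Counting index tuples by their set of differences -/

section Counting

variable {h : ℕ} {K : Pair h → Type*} [∀ s, Fintype (K s)] [∀ s, DecidableEq (K s)]

/-- Coordinates outside `T` are forced to equal those of `k`; those in `T` range over at most all of
`K s`. -/
theorem card_diffSet_eq_le (k : ∀ s, K s) (T : Finset (Pair h)) :
    (Finset.univ.filter fun k' => diffSet k k' = T).card ≤ ∏ s ∈ T, Fintype.card (K s) := by
  calc (Finset.univ.filter fun k' => diffSet k k' = T).card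
      ≤ (Fintype.piFinset fun s => if s ∈ T then Finset.univ else {k s}).card := by
        refine Finset.card_le_card fun k' hk' => ?_
        rw [Finset.mem_filter] at hk'
        rw [Fintype.mem_piFinset]
        intro s
        split_ifs with hs
        · exact Finset.mem_univ _
        · rw [← hk'.2] at hs
          simp only [diffSet, Finset.mem_filter, Finset.mem_univ, true_and, not_not] at hs
          rw [Finset.mem_singleton, hs]
    _ = ∏ s ∈ T, Fintype.card (K s) := by
        rw [Fintype.card_piFinset]
        have : ∀ s, (if s ∈ T then (Finset.univ : Finset (K s)) else {k s}).card =
            if s ∈ T then Fintype.card (K s) else 1 := by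
          intro s
          split_ifs <;> simp
        simp only [this, Finset.prod_ite_mem, Finset.univ_inter]

/-- Averaging a function of the set of differences with a fixed index tuple. -/
theorem sum_diffSet_div_le [∀ s, Nonempty (K s)] (p : Pair h) (k : ∀ s, K s)
    (ρ : Finset (Pair h) → ℝ) (hρ : ∀ T, 0 ≤ ρ T) (hρ1 : ∀ T, p ∈ T → ρ T ≤ 1) :
    (∑ k', ρ (diffSet k k')) / ∏ s, (Fintype.card (K s) : ℝ) ≤
      1 + ∑ T with p ∉ T, (∏ s ∈ Tᶜ, (Fintype.card (K s) : ℝ)⁻¹) * ρ T := by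
  have hcard : ∀ s, (0 : ℝ) < Fintype.card (K s) := fun s => Nat.cast_pos.mpr Fintype.card_pos
  have hP : 0 < ∏ s, (Fintype.card (K s) : ℝ) := Finset.prod_pos fun s _ => hcard s
  -- Tuples differing from `k` at `p` contribute at most 1 after averaging. The others are grouped
  -- by their set of differences.
  rw [div_le_iff₀ hP, ← Finset.sum_filter_add_sum_filter_not Finset.univ
    (fun k' => p ∈ diffSet k k'), add_mul, one_mul]
  refine add_le_add ?_ ?_
  · calc ∑ k' with p ∈ diffSet k k', ρ (diffSet k k')
        ≤ ∑ k' : ∀ s, K s with p ∈ diffSet k k', (1 : ℝ) :=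
          Finset.sum_le_sum fun k' hk' => hρ1 _ (Finset.mem_filter.mp hk').2
      _ ≤ ∑ k' : ∀ s, K s, (1 : ℝ) :=
          Finset.sum_le_sum_of_subset_of_nonneg (Finset.filter_subset _ _)
            fun _ _ _ => zero_le_one
      _ = ∏ s, (Fintype.card (K s) : ℝ) := by simp [Fintype.card_pi]
  · rw [← Finset.sum_fiberwise_of_maps_to (t := Finset.univ.filter fun T => p ∉ T)
      (g := fun k' => diffSet k k') (by intro k' hk'; simpa using hk'), Finset.sum_mul]
    refine Finset.sum_le_sum fun T _ => ?_
    calc ∑ k' ∈ Finset.univ.filter (fun k' => p ∉ diffSet k k') with diffSet k k' = T,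
          ρ (diffSet k k')
        = ∑ k' ∈ Finset.univ.filter (fun k' => p ∉ diffSet k k') with diffSet k k' = T, ρ T :=
          Finset.sum_congr rfl fun k' hk' => by rw [(Finset.mem_filter.mp hk').2]
      _ ≤ ∑ k' with diffSet k k' = T, ρ T :=
          Finset.sum_le_sum_of_subset_of_nonneg
            (Finset.filter_subset_filter _ (Finset.filter_subset _ _)) fun _ _ _ => hρ T
      _ = (Finset.univ.filter fun k' => diffSet k k' = T).card * ρ T := by
          rw [Finset.sum_const, nsmul_eq_mul]
      _ ≤ (∏ s ∈ T, (Fintype.card (K s) : ℝ)) * ρ T :=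
          mul_le_mul_of_nonneg_right (by exact_mod_cast card_diffSet_eq_le k T) (hρ T)
      _ = (∏ s ∈ Tᶜ, (Fintype.card (K s) : ℝ)⁻¹) * ρ T * ∏ s, (Fintype.card (K s) : ℝ) := by
          rw [← Finset.prod_mul_prod_compl T (fun s => (Fintype.card (K s) : ℝ)),
            Finset.prod_inv_distrib]
          have : ∏ s ∈ Tᶜ, (Fintype.card (K s) : ℝ) ≠ 0 :=
            Finset.prod_ne_zero_iff.mpr fun s _ => (hcard s).ne'
          field_simp

end Counting

/-! ### The soft-covering bound -/

section SoftCovering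

theorem diffSet_comp {h : ℕ} {K : Pair h → Type*} [∀ s, DecidableEq (K s)]
    {μp μm : Pair h → ℝ} {n : ℕ} {e : ∀ s, K s → Idx μp μm n s}
    (he : ∀ s, Function.Injective (e s)) (k k' : ∀ s, K s) :
    diffSet (fun s => e s (k s)) (fun s => e s (k' s)) = diffSet k k' := by
  ext s
  simp [diffSet, (he s).eq_iff]

variable {h : ℕ} {𝒜 : Pair h → Type*} {𝒳 : Fin h → Type*} {μp μm : Pair h → ℝ} {n : ℕ}
  [∀ s, Fintype (𝒜 s)] [∀ k, Fintype (𝒳 k)] {Q : Sample 𝒜 𝒳 → ℝ}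
  {K : Pair h → Type*} [∀ s, Fintype (K s)]

/-- The channel output pmf when the index tuple is the image under `e` of a uniform one. -/
noncomputable def avgOut {β : Type*} (Q : Sample 𝒜 𝒳 → ℝ) (f : Sample 𝒜 𝒳 → β)
    (e : ∀ s, K s → Idx μp μm n s) (c : Codebook 𝒜 μp μm n) (y : Fin n → β) : ℝ :=
  (∑ k : ∀ s, K s, channel Q f c (fun s => e s (k s)) y) / ∏ s, (Fintype.card (K s) : ℝ)

/-- The likelihood of a word, relative to the output law, on the layers outside `J_T`. -/
noncomputable def layerRatio {β : Type*} (Q : Sample 𝒜 𝒳 → ℝ) (f : Sample 𝒜 𝒳 → β)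
    (T : Finset (Pair h)) (a : Fin n → ∀ s, 𝒜 s) (y : Fin n → β) : ℝ :=
  ∏ t, infoRatio Q f (rvAOn (jSet T)ᶜ) (y t) (fun s => a t s)

/-- An upper bound for the conditional mean of the likelihood ratio of the output given one of
the words. -/
noncomputable def meanBound {β : Type*} (Q : Sample 𝒜 𝒳 → ℝ) (f : Sample 𝒜 𝒳 → β)
    (K : Pair h → Type*) [∀ s, Fintype (K s)]
    (p : Pair h) (a : Fin n → ∀ s, 𝒜 s) (y : Fin n → β) : ℝ :=
  1 + ∑ T with p ∉ T, (∏ s ∈ Tᶜ, (Fintype.card (K s) : ℝ)⁻¹) * layerRatio Q f T a y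

theorem layerRatio_nonneg {β : Type*} (hQ : Q ∈ stdSimplex ℝ (Sample 𝒜 𝒳)) (f : Sample 𝒜 𝒳 → β)
    (T : Finset (Pair h)) (a : Fin n → ∀ s, 𝒜 s) (y : Fin n → β) : 0 ≤ layerRatio Q f T a y :=
  Finset.prod_nonneg fun _ _ => infoRatio_nonneg hQ.1 _ _ _ _

/-- With `topPair hh` in `T` no layer lies outside `jSet T`, so the conditioning is trivial and each
factor is `q / q`. This is 1, or 0 when `q = 0`, hence an inequality. -/
theorem layerRatio_le_one {β : Type*} (hh : 2 ≤ h) (hQ : Q ∈ stdSimplex ℝ (Sample 𝒜 𝒳))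
    (f : Sample 𝒜 𝒳 → β) {T : Finset (Pair h)} (hT : topPair hh ∈ T) (a : Fin n → ∀ s, 𝒜 s)
    (y : Fin n → β) : layerRatio Q f T a y ≤ 1 := by
  refine Finset.prod_le_one (fun _ _ => infoRatio_nonneg hQ.1 _ _ _ _) fun t _ => ?_
  have hemp : ∀ s ∈ (jSet T)ᶜ, False := fun s hs =>
    mem_jSet_compl.mp hs _ (topPair_mem_phiBar hh s) hT
  have hall : ∀ ω : Sample 𝒜 𝒳, rvAOn (jSet T)ᶜ ω = fun s : ((jSet T)ᶜ : Finset _) => a t s :=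
    fun ω => rvAOn_eq_iff.mpr fun s hs => (hemp s hs).elim
  have h1 : law Q (rvAOn (jSet T)ᶜ) (fun s => a t s) = 1 := by
    rw [law_eq_sum_ite, ← hQ.2]
    exact Finset.sum_congr rfl fun ω _ => if_pos (hall ω)
  unfold infoRatio cond
  rw [h1, div_one, law_congr_event (g := f) (c := y t) (by intro ω; simp [hall])]
  exact div_self_le_one _

theorem one_le_meanBound {β : Type*} (hQ : Q ∈ stdSimplex ℝ (Sample 𝒜 𝒳)) (f : Sample 𝒜 𝒳 → β)
    (p : Pair h) (a : Fin n → ∀ s, 𝒜 s) (y : Fin n → β) : 1 ≤ meanBound Q f K p a y := by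
  unfold meanBound
  have : 0 ≤ ∑ T with p ∉ T,
      (∏ s ∈ Tᶜ, (Fintype.card (K s) : ℝ)⁻¹) * layerRatio Q f T a y :=
    Finset.sum_nonneg fun T _ => mul_nonneg
      (Finset.prod_nonneg fun s _ => inv_nonneg.mpr (Nat.cast_nonneg _))
      (layerRatio_nonneg hQ f T a y)
  linarith

theorem channel_nonneg {β : Type*} (hQ : Q ∈ stdSimplex ℝ (Sample 𝒜 𝒳)) (f : Sample 𝒜 𝒳 → β)
    (c : Codebook 𝒜 μp μm n) (m : ∀ s, Idx μp μm n s) (y : Fin n → β) : 0 ≤ channel Q f c m y :=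
  Finset.prod_nonneg fun _ _ => cond_nonneg hQ.1 _ _ _ _

theorem codebookProb_nonneg (hQ : Q ∈ stdSimplex ℝ (Sample 𝒜 𝒳)) (c : Codebook 𝒜 μp μm n) :
    0 ≤ codebookProb Q c :=
  Finset.prod_nonneg fun _ _ => Finset.prod_nonneg fun _ _ => Finset.prod_nonneg fun _ _ =>
    cond_nonneg hQ.1 _ _ _ _

theorem iidPmf_nonneg {β : Type*} (hQ : Q ∈ stdSimplex ℝ (Sample 𝒜 𝒳)) (f : Sample 𝒜 𝒳 → β)
    (y : Fin n → β) : 0 ≤ iidPmf Q f n y :=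
  Finset.prod_nonneg fun _ _ => law_nonneg hQ.1 _ _

theorem channel_eq_zero_of_iidPmf {β : Type*} (hQ : Q ∈ stdSimplex ℝ (Sample 𝒜 𝒳))
    (f : Sample 𝒜 𝒳 → β) (c : Codebook 𝒜 μp μm n) (m : ∀ s, Idx μp μm n s) {y : Fin n → β}
    (hy : iidPmf Q f n y = 0) : channel Q f c m y = 0 := by
  obtain ⟨t, ht, h0⟩ := Finset.prod_eq_zero_iff.mp hy
  exact Finset.prod_eq_zero ht (cond_eq_zero_of_law hQ.1 _ _ _ h0)

/-- The likelihood ratio of the output has conditional mean at most `meanBound` given a word. -/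
theorem sum_codebookProb_mul_avgOut_le {β : Type*} [∀ s, Nonempty (K s)] (hh : 2 ≤ h)
    (hQ : Q ∈ stdSimplex ℝ (Sample 𝒜 𝒳)) (hA : LayeredMarkov Q) (f : Sample 𝒜 𝒳 → β)
    {e : ∀ s, K s → Idx μp μm n s} (he : ∀ s, Function.Injective (e s)) (k : ∀ s, K s)
    (G : (Fin n → ∀ s, 𝒜 s) → ℝ) (hG : ∀ a, 0 ≤ G a) (y : Fin n → β) :
    ∑ c : Codebook 𝒜 μp μm n, codebookProb Q c *
        (G (codeSymbol c fun s => e s (k s)) * (avgOut Q f e c y / iidPmf Q f n y)) ≤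
      ∑ a : Fin n → ∀ s, 𝒜 s, (∏ t, law Q rvAll (a t)) *
        (G a * meanBound Q f K (topPair hh) a y) := by
  classical
  have h1 : ∑ c : Codebook 𝒜 μp μm n, codebookProb Q c *
        (G (codeSymbol c fun s => e s (k s)) * (avgOut Q f e c y / iidPmf Q f n y)) =
      ∑ a : Fin n → ∀ s, 𝒜 s, (∏ t, law Q rvAll (a t)) * (G a *
        ((∑ k', layerRatio Q f (diffSet k k') a y) / ∏ s, (Fintype.card (K s) : ℝ))) := by
    calc _ = ∑ k' : ∀ s, K s, (∑ c : Codebook 𝒜 μp μm n, codebookProb Q c *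
          (G (codeSymbol c fun s => e s (k s)) * channel Q f c (fun s => e s (k' s)) y)) /
            (iidPmf Q f n y * ∏ s, (Fintype.card (K s) : ℝ)) := by
          rw [← Finset.sum_div, Finset.sum_comm, Finset.sum_div]
          refine Finset.sum_congr rfl fun c _ => ?_
          unfold avgOut
          rw [← Finset.mul_sum, ← Finset.mul_sum]
          ring
      _ = _ := by
          simp only [sum_codebookProb_mul_channel hQ hA]
          rw [← Finset.sum_div, Finset.sum_comm, Finset.sum_div]
          refine Finset.sum_congr rfl fun a _ => ?_
          rw [← Finset.mul_sum, ← Finset.mul_sum]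
          have : ∀ k', layerRatio Q f (diffSet k k') a y =
              (∏ t, cond Q f (rvAOn (jSet (diffSet (fun s => e s (k s)) fun s => e s (k' s)))ᶜ)
                (y t) fun s => a t s) / iidPmf Q f n y := by
            intro k'
            rw [← diffSet_comp he k k']
            unfold layerRatio infoRatio iidPmf
            rw [Finset.prod_div_distrib]
          simp only [this]
          rw [← Finset.sum_div]
          ring
  rw [h1]
  refine Finset.sum_le_sum fun a _ => mul_le_mul_of_nonneg_left
    (mul_le_mul_of_nonneg_left ?_ (hG a)) (Finset.prod_nonneg fun _ _ => law_nonneg hQ.1 _ _)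
  exact sum_diffSet_div_le (topPair hh) k (fun T => layerRatio Q f T a y)
    (fun T => layerRatio_nonneg hQ f T a y) (fun T hT => layerRatio_le_one hh hQ f hT a y)

/-- The expected log-likelihood ratio of the output, weighted by one of the words. -/
theorem sum_codebookProb_mul_log_le {β : Type*} [∀ s, Nonempty (K s)] (hh : 2 ≤ h)
    (hQ : Q ∈ stdSimplex ℝ (Sample 𝒜 𝒳)) (hA : LayeredMarkov Q) (f : Sample 𝒜 𝒳 → β)
    {e : ∀ s, K s → Idx μp μm n s} (he : ∀ s, Function.Injective (e s)) (k : ∀ s, K s)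
    (y : Fin n → β) :
    ∑ c : Codebook 𝒜 μp μm n, codebookProb Q c * (channel Q f c (fun s => e s (k s)) y *
        Real.log (avgOut Q f e c y / iidPmf Q f n y)) ≤
      ∑ a : Fin n → ∀ s, 𝒜 s, (∏ t, law Q rvAll (a t)) * ((∏ t, cond Q f rvAll (y t) (a t)) *
        Real.log (meanBound Q f K (topPair hh) a y)) := by
  set B := fun a : Fin n → ∀ s, 𝒜 s => meanBound Q f K (topPair hh) a y with hB
  have hB1 : ∀ a, 1 ≤ B a := fun a => one_le_meanBound hQ f _ a y
  set W := fun a : Fin n → ∀ s, 𝒜 s => ∏ t, cond Q f rvAll (y t) (a t) with hW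
  have hW0 : ∀ a, 0 ≤ W a := fun a => Finset.prod_nonneg fun _ _ => cond_nonneg hQ.1 _ _ _ _
  -- Jensen's inequality in tangent form, `log z ≤ log B + (z / B - 1)`, with `B` the bound for the
  -- conditional mean of `z`. After taking expectations the correction term is at most 0.
  have hpoint : ∀ c : Codebook 𝒜 μp μm n,
      codebookProb Q c * (channel Q f c (fun s => e s (k s)) y *
        Real.log (avgOut Q f e c y / iidPmf Q f n y)) ≤
      codebookProb Q c * (W (codeSymbol c fun s => e s (k s)) *
        Real.log (B (codeSymbol c fun s => e s (k s)))) +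
      (codebookProb Q c * (W (codeSymbol c fun s => e s (k s)) /
        B (codeSymbol c fun s => e s (k s)) * (avgOut Q f e c y / iidPmf Q f n y)) -
      codebookProb Q c * W (codeSymbol c fun s => e s (k s))) := by
    intro c
    set w := codeSymbol c fun s => e s (k s)
    have hch : channel Q f c (fun s => e s (k s)) y = W w := rfl
    rw [hch, ← mul_sub, ← mul_add]
    refine mul_le_mul_of_nonneg_left ?_ (codebookProb_nonneg hQ c)
    rcases (hW0 w).eq_or_lt with h0 | hpos
    · rw [← h0]
      simp
    · have hq : 0 < iidPmf Q f n y := by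
        refine lt_of_le_of_ne (iidPmf_nonneg hQ f y) fun hq => hpos.ne' ?_
        rw [← hch]
        exact channel_eq_zero_of_iidPmf hQ f c _ hq.symm
      have hcard : ∀ s, (0 : ℝ) < Fintype.card (K s) := fun s => Nat.cast_pos.mpr Fintype.card_pos
      -- The average contains the term of the word `k` itself, which is positive here.
      have hZ : 0 < avgOut Q f e c y := by
        refine div_pos (hpos.trans_le ?_) (Finset.prod_pos fun s _ => hcard s)
        rw [← hch]
        exact Finset.single_le_sum (f := fun k : ∀ s, K s => channel Q f c (fun s => e s (k s)) y)
          (fun k _ => channel_nonneg hQ f c _ y) (Finset.mem_univ k)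
      have hBpos : 0 < B w := zero_lt_one.trans_le (hB1 w)
      have hlog := Real.log_le_sub_one_of_pos (div_pos (div_pos hZ hq) hBpos)
      rw [Real.log_div (div_pos hZ hq).ne' hBpos.ne'] at hlog
      calc W w * Real.log (avgOut Q f e c y / iidPmf Q f n y)
          ≤ W w * (Real.log (B w) + (avgOut Q f e c y / iidPmf Q f n y / B w - 1)) :=
            mul_le_mul_of_nonneg_left (by linarith) hpos.le
        _ = _ := by ring
  refine (Finset.sum_le_sum fun c _ => hpoint c).trans ?_
  rw [Finset.sum_add_distrib, Finset.sum_sub_distrib,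
    sum_codebookProb_mul_word hQ hA (fun s => e s (k s)) (fun a => W a * Real.log (B a)),
    sum_codebookProb_mul_word hQ hA (fun s => e s (k s)) W]
  -- Weighting by `W / B` makes the factor `meanBound` cancel, so the expectation of the tangent
  -- term is at most that of `W`.
  have hZ := sum_codebookProb_mul_avgOut_le hh hQ hA f he k (fun a => W a / B a)
    (fun a => div_nonneg (hW0 a) (zero_le_one.trans (hB1 a))) y
  have hcancel : ∀ a, W a / B a * meanBound Q f K (topPair hh) a y = W a := fun a =>
    div_mul_cancel₀ _ (zero_lt_one.trans_le (hB1 a)).ne'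
  simp only [hcancel] at hZ
  linarith

/-- The tilted moments of the likelihood ratios factorize over time. -/
theorem sum_sum_mul_layerRatio_rpow {β : Type*} [Fintype β] (hQ : Q ∈ stdSimplex ℝ (Sample 𝒜 𝒳))
    (f : Sample 𝒜 𝒳 → β) (T : Finset (Pair h)) (θ : ℝ) :
    ∑ y : Fin n → β, ∑ a : Fin n → ∀ s, 𝒜 s, (∏ t, law Q rvAll (a t)) *
        ((∏ t, cond Q f rvAll (y t) (a t)) * layerRatio Q f T a y ^ θ) =
      infoMoment Q f (rvAOn (jSet T)ᶜ) θ ^ n := by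
  classical
  have h1 : infoMoment Q f (rvAOn (jSet T)ᶜ) θ = ∑ p : β × (∀ s, 𝒜 s),
      law Q (fun ω => (f ω, rvAll ω)) p *
        infoRatio Q f (rvAOn (jSet T)ᶜ) p.1 (fun s => p.2 s) ^ θ :=
    sum_mul_comp (fun ω => (f ω, rvAll ω)) fun p : β × (∀ s, 𝒜 s) =>
      infoRatio Q f (rvAOn (jSet T)ᶜ) p.1 (fun s => p.2 s) ^ θ
  rw [h1, Fintype.sum_pow, ← Equiv.sum_comp (Equiv.arrowProdEquivProdArrow (Fin n) (fun _ => β)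
    (fun _ => ∀ s, 𝒜 s)).symm, Fintype.sum_prod_type]
  refine Finset.sum_congr rfl fun y _ => Finset.sum_congr rfl fun a _ => ?_
  unfold layerRatio
  rw [← Real.finsetProd_rpow _ _ (fun _ _ => infoRatio_nonneg hQ.1 _ _ _ _), ← mul_assoc,
    ← Finset.prod_mul_distrib, ← Finset.prod_mul_distrib]
  refine Finset.prod_congr rfl fun t _ => ?_
  rw [mul_comm (law Q rvAll (a t)), cond_mul_law hQ.1]
  rfl

/-- Soft covering by superposition codebooks, for index sets of arbitrary sizes. -/
theorem sum_codebookProb_mul_divergence_le {β : Type*} [Fintype β] [∀ s, Nonempty (K s)]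
    (hh : 2 ≤ h) (hQ : Q ∈ stdSimplex ℝ (Sample 𝒜 𝒳)) (hA : LayeredMarkov Q)
    (f : Sample 𝒜 𝒳 → β) {e : ∀ s, K s → Idx μp μm n s} (he : ∀ s, Function.Injective (e s))
    {θ : ℝ} (hθ : 0 < θ) (hθ1 : θ ≤ 1) :
    ∑ c : Codebook 𝒜 μp μm n, codebookProb Q c * ∑ y, avgOut Q f e c y *
        Real.log (avgOut Q f e c y / iidPmf Q f n y) ≤
      ∑ T with topPair hh ∉ T, (∏ s ∈ Tᶜ, (Fintype.card (K s) : ℝ)⁻¹) ^ θ / θ *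
        infoMoment Q f (rvAOn (jSet T)ᶜ) θ ^ n := by
  classical
  have hcard : ∀ s, (0 : ℝ) < Fintype.card (K s) := fun s => Nat.cast_pos.mpr Fintype.card_pos
  have hP : 0 < ∏ s, (Fintype.card (K s) : ℝ) := Finset.prod_pos fun s _ => hcard s
  calc ∑ c : Codebook 𝒜 μp μm n, codebookProb Q c * ∑ y, avgOut Q f e c y *
        Real.log (avgOut Q f e c y / iidPmf Q f n y)
      = (∑ k : ∀ s, K s, ∑ y, ∑ c : Codebook 𝒜 μp μm n, codebookProb Q c *
          (channel Q f c (fun s => e s (k s)) y *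
            Real.log (avgOut Q f e c y / iidPmf Q f n y))) / ∏ s, (Fintype.card (K s) : ℝ) := by
        rw [Finset.sum_comm]
        simp only [Finset.mul_sum]
        rw [Finset.sum_comm, Finset.sum_div]
        refine Finset.sum_congr rfl fun y _ => ?_
        rw [Finset.sum_comm, Finset.sum_div]
        refine Finset.sum_congr rfl fun c _ => ?_
        rw [← Finset.mul_sum, ← Finset.sum_mul]
        conv_lhs => rw [avgOut]
        unfold avgOut
        ring
    _ ≤ (∑ _k : ∀ s, K s, ∑ y, ∑ a : Fin n → ∀ s, 𝒜 s, (∏ t, law Q rvAll (a t)) *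
          ((∏ t, cond Q f rvAll (y t) (a t)) * Real.log (meanBound Q f K (topPair hh) a y))) /
            ∏ s, (Fintype.card (K s) : ℝ) :=
        div_le_div_of_nonneg_right (Finset.sum_le_sum fun k _ => Finset.sum_le_sum fun y _ =>
          sum_codebookProb_mul_log_le hh hQ hA f he k y) hP.le
    -- The bound is the same for every `k`, so averaging over `k` disappears.
    _ = ∑ y, ∑ a : Fin n → ∀ s, 𝒜 s, (∏ t, law Q rvAll (a t)) *
          ((∏ t, cond Q f rvAll (y t) (a t)) * Real.log (meanBound Q f K (topPair hh) a y)) := by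
        rw [Finset.sum_const, Finset.card_univ, Fintype.card_pi, nsmul_eq_mul, Nat.cast_prod,
          mul_div_cancel_left₀ _ hP.ne']
    _ ≤ ∑ y, ∑ a : Fin n → ∀ s, 𝒜 s, (∏ t, law Q rvAll (a t)) *
          ((∏ t, cond Q f rvAll (y t) (a t)) * ∑ T with topPair hh ∉ T,
            (∏ s ∈ Tᶜ, (Fintype.card (K s) : ℝ)⁻¹) ^ θ / θ * layerRatio Q f T a y ^ θ) := by
        refine Finset.sum_le_sum fun y _ => Finset.sum_le_sum fun a _ =>
          mul_le_mul_of_nonneg_left (mul_le_mul_of_nonneg_left ?_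
            (Finset.prod_nonneg fun _ _ => cond_nonneg hQ.1 _ _ _ _))
            (Finset.prod_nonneg fun _ _ => law_nonneg hQ.1 _ _)
        have hw : ∀ T : Finset (Pair h), 0 ≤ ∏ s ∈ Tᶜ, (Fintype.card (K s) : ℝ)⁻¹ := fun T =>
          Finset.prod_nonneg fun s _ => inv_nonneg.mpr (Nat.cast_nonneg _)
        refine (log_one_add_sum_le _ _ (fun T _ => mul_nonneg (hw T)
          (layerRatio_nonneg hQ f T a y)) hθ hθ1).trans_eq ?_
        refine Finset.sum_congr rfl fun T _ => ?_
        rw [Real.mul_rpow (hw T) (layerRatio_nonneg hQ f T a y)]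
        ring
    _ = _ := by
        simp only [Finset.mul_sum]
        simp only [Finset.sum_comm (t := Finset.univ.filter fun T : Finset (Pair h) =>
          topPair hh ∉ T)]
        refine Finset.sum_congr rfl fun T _ => ?_
        rw [← sum_sum_mul_layerRatio_rpow hQ f T θ, Finset.mul_sum]
        refine Finset.sum_congr rfl fun y _ => ?_
        rw [Finset.mul_sum]
        refine Finset.sum_congr rfl fun a _ => ?_
        ring

end SoftCovering

end LineCoord

namespace LineCoord

/-! ### Real-valued divergence and the compensation identity -/

section Divergence

theorem coe_sum_eReal {ι : Type*} (s : Finset ι) (f : ι → ℝ) :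
    ((∑ i ∈ s, f i : ℝ) : EReal) = ∑ i ∈ s, (f i : EReal) := by
  classical
  induction s using Finset.induction_on with
  | empty => simp
  | insert i s hi ih => rw [Finset.sum_insert hi, Finset.sum_insert hi, EReal.coe_add, ih]

variable {β : Type*} [Fintype β] {p q : β → ℝ}

/-- The Kullback–Leibler divergence in nats, as a real number. -/
noncomputable def realDiv (p q : β → ℝ) : ℝ := ∑ b, p b * Real.log (p b / q b)

theorem klDiv_eq_coe (hpq : ∀ b, q b = 0 → p b = 0) :
    klDiv p q = ((realDiv p q / Real.log 2 : ℝ) : EReal) := by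
  unfold klDiv realDiv
  rw [if_pos hpq, Finset.sum_div]
  simp only [Real.logb, mul_div_assoc]

/-- Summing the pointwise inequality `p - q ≤ p * log (p / q)`, which follows from `log u ≤ u - 1`
at `u = q / p`. -/
theorem realDiv_nonneg (hp : ∀ b, 0 ≤ p b) (hq : ∀ b, 0 ≤ q b) (hpq : ∀ b, q b = 0 → p b = 0)
    (hsum : ∑ b, q b ≤ ∑ b, p b) : 0 ≤ realDiv p q := by
  have hpoint : ∀ b, p b - q b ≤ p b * Real.log (p b / q b) := by
    intro b
    rcases (hp b).eq_or_lt with h0 | hpos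
    · rw [← h0]
      simpa using hq b
    · have hqpos : 0 < q b := lt_of_le_of_ne (hq b) fun h => hpos.ne' (hpq b h.symm)
      have hlog := Real.log_le_sub_one_of_pos (div_pos hqpos hpos)
      rw [← inv_div, Real.log_inv] at hlog
      have h1 := mul_le_mul_of_nonneg_left hlog hpos.le
      have h2 : p b * ((p b / q b)⁻¹ - 1) = q b - p b := by
        field_simp
      rw [h2] at h1
      linarith
  have := Finset.sum_le_sum fun b (_ : b ∈ Finset.univ) => hpoint b
  rw [Finset.sum_sub_distrib] at this
  unfold realDiv
  linarith

/-- The mean divergence from the average of a family is at most that from any other pmf. -/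
theorem sum_realDiv_average_le {ι : Type*} [Fintype ι] [Nonempty ι] {P : ι → β → ℝ} {r : β → ℝ}
    (hP : ∀ i b, 0 ≤ P i b) (hr : ∀ b, r b = (∑ i, P i b) / Fintype.card ι)
    (hrq : ∀ b, q b = 0 → r b = 0) (hdiv : 0 ≤ realDiv r q) :
    ∑ i, realDiv (P i) r ≤ ∑ i, realDiv (P i) q := by
  have hcard : (0 : ℝ) < Fintype.card ι := Nat.cast_pos.mpr Fintype.card_pos
  have hterm : ∀ i b, P i b * Real.log (P i b / r b) =
      P i b * Real.log (P i b / q b) - P i b * Real.log (r b / q b) := by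
    intro i b
    by_cases h0 : P i b = 0
    · simp [h0]
    · have hrb : r b ≠ 0 := by
        rw [hr]
        refine div_ne_zero (fun hz => h0 ?_) hcard.ne'
        exact (Finset.sum_eq_zero_iff_of_nonneg fun i _ => hP i b).mp hz i (Finset.mem_univ i)
      have hqb : q b ≠ 0 := fun hz => hrb (hrq b hz)
      rw [Real.log_div h0 hrb, Real.log_div h0 hqb, Real.log_div hrb hqb]
      ring
  -- Compensation identity: moving the reference from `q` to the average `r` lowers the total
  -- divergence by exactly `card ι` times the divergence of `r` from `q`.
  have hsum : ∑ i, realDiv (P i) r = ∑ i, realDiv (P i) q - Fintype.card ι * realDiv r q := by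
    unfold realDiv
    simp only [hterm, Finset.sum_sub_distrib]
    congr 1
    rw [Finset.sum_comm, Finset.mul_sum]
    refine Finset.sum_congr rfl fun b _ => ?_
    rw [← Finset.sum_mul, ← mul_assoc]
    congr 1
    rw [hr]
    field_simp
  rw [hsum]
  have := mul_nonneg hcard.le hdiv
  linarith

end Divergence

/-! ### Rates, vanishing bounds and the two limits -/

section Assembly

variable {h : ℕ} {𝒜 : Pair h → Type*} {𝒳 : Fin h → Type*} {μp μm : Pair h → ℝ} {n : ℕ}

theorem one_le_two_rpow_nat_mul {μ : ℝ} (hμ : 0 ≤ μ) (n : ℕ) : 1 ≤ (2 : ℝ) ^ ((n : ℝ) * μ) :=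
  Real.one_le_rpow one_le_two (mul_nonneg (Nat.cast_nonneg n) hμ)

theorem numIdx_pos {μ : ℝ} (hμ : 0 ≤ μ) (n : ℕ) : 0 < numIdx n μ :=
  Nat.floor_pos.mpr (one_le_two_rpow_nat_mul hμ n)

/-- For `x ≥ 1` one has `x ≤ ⌊x⌋ + 1 ≤ 2 ⌊x⌋`, so the floor costs at most a factor 2. Nonnegativity
of the rate gives `x ≥ 1`. -/
theorem two_rpow_le_two_mul_numIdx {μ : ℝ} (hμ : 0 ≤ μ) (n : ℕ) :
    (2 : ℝ) ^ ((n : ℝ) * μ) ≤ 2 * numIdx n μ := by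
  have h1 : (1 : ℝ) ≤ numIdx n μ := by exact_mod_cast numIdx_pos hμ n
  have h2 := (Nat.lt_floor_add_one ((2 : ℝ) ^ ((n : ℝ) * μ))).le
  have h3 : (⌊(2 : ℝ) ^ ((n : ℝ) * μ)⌋₊ : ℝ) = numIdx n μ := rfl
  rw [h3] at h2
  linarith

variable [∀ s, Fintype (𝒜 s)] [∀ k, Fintype (𝒳 k)] {Q : Sample 𝒜 𝒳 → ℝ}

theorem expect_coe (d : Codebook 𝒜 μp μm n → ℝ) :
    expect Q (fun c => (d c : EReal)) = ((∑ c, codebookProb Q c * d c : ℝ) : EReal) := by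
  unfold expect
  rw [coe_sum_eReal]
  simp only [EReal.coe_mul]

/-- The kernels in the factorization of the law of one symbol vector are among the factors of the
codebook probability. -/
theorem law_codeSymbol_ne_zero (hQ : Q ∈ stdSimplex ℝ (Sample 𝒜 𝒳)) (hA : LayeredMarkov Q)
    {c : Codebook 𝒜 μp μm n} (hc : codebookProb Q c ≠ 0) (m : ∀ s, Idx μp μm n s) (t : Fin n) :
    law Q rvAll (codeSymbol c m t) ≠ 0 := by
  rw [law_rvAll_eq_prod hQ hA, Finset.prod_ne_zero_iff]
  intro s _
  have h1 := Finset.prod_ne_zero_iff.mp hc s (Finset.mem_univ s)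
  have h2 := Finset.prod_ne_zero_iff.mp h1 (fun r => m r) (Finset.mem_univ _)
  exact Finset.prod_ne_zero_iff.mp h2 t (Finset.mem_univ t)

theorem sum_channel {β : Type*} [Fintype β] (hQ : Q ∈ stdSimplex ℝ (Sample 𝒜 𝒳))
    (hA : LayeredMarkov Q) (f : Sample 𝒜 𝒳 → β) {c : Codebook 𝒜 μp μm n}
    (hc : codebookProb Q c ≠ 0) (m : ∀ s, Idx μp μm n s) : ∑ y, channel Q f c m y = 1 := by
  classical
  have h3 := (Finset.prod_univ_sum (fun _ : Fin n => (Finset.univ : Finset β))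
      (fun t b => cond Q f rvAll b (codeSymbol c m t))).symm
  rw [Fintype.piFinset_univ] at h3
  unfold channel
  rw [h3]
  exact Finset.prod_eq_one fun t _ => sum_cond _ _ (law_codeSymbol_ne_zero hQ hA hc m t)

theorem sum_iidPmf {β : Type*} [Fintype β] (hQ : Q ∈ stdSimplex ℝ (Sample 𝒜 𝒳))
    (f : Sample 𝒜 𝒳 → β) : ∑ y, iidPmf Q f n y = 1 := by
  unfold iidPmf
  rw [← Fintype.sum_pow, sum_law, hQ.2, one_pow]

section AvgOut

variable {β : Type*} {K : Pair h → Type*} [∀ s, Fintype (K s)]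

theorem avgOut_nonneg (hQ : Q ∈ stdSimplex ℝ (Sample 𝒜 𝒳)) (f : Sample 𝒜 𝒳 → β)
    (e : ∀ s, K s → Idx μp μm n s) (c : Codebook 𝒜 μp μm n) (y : Fin n → β) :
    0 ≤ avgOut Q f e c y :=
  div_nonneg (Finset.sum_nonneg fun _ _ => channel_nonneg hQ f c _ y)
    (Finset.prod_nonneg fun _ _ => Nat.cast_nonneg _)

theorem avgOut_eq_zero_of_iidPmf (hQ : Q ∈ stdSimplex ℝ (Sample 𝒜 𝒳)) (f : Sample 𝒜 𝒳 → β)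
    (e : ∀ s, K s → Idx μp μm n s) (c : Codebook 𝒜 μp μm n) (y : Fin n → β)
    (hy : iidPmf Q f n y = 0) : avgOut Q f e c y = 0 := by
  unfold avgOut
  rw [Finset.sum_eq_zero fun k _ => channel_eq_zero_of_iidPmf hQ f c _ hy, zero_div]

theorem sum_avgOut [Fintype β] [∀ s, Nonempty (K s)] (hQ : Q ∈ stdSimplex ℝ (Sample 𝒜 𝒳))
    (hA : LayeredMarkov Q) (f : Sample 𝒜 𝒳 → β) (e : ∀ s, K s → Idx μp μm n s)
    {c : Codebook 𝒜 μp μm n} (hc : codebookProb Q c ≠ 0) : ∑ y, avgOut Q f e c y = 1 := by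
  classical
  unfold avgOut
  rw [← Finset.sum_div, Finset.sum_comm]
  simp only [sum_channel hQ hA f hc]
  rw [Finset.sum_const, Finset.card_univ, Fintype.card_pi, nsmul_eq_mul, mul_one, Nat.cast_prod]
  exact div_self (Finset.prod_ne_zero_iff.mpr fun s _ => Nat.cast_ne_zero.mpr Fintype.card_ne_zero)

theorem realDiv_avgOut_nonneg [Fintype β] [∀ s, Nonempty (K s)]
    (hQ : Q ∈ stdSimplex ℝ (Sample 𝒜 𝒳)) (hA : LayeredMarkov Q) (f : Sample 𝒜 𝒳 → β)
    (e : ∀ s, K s → Idx μp μm n s) {c : Codebook 𝒜 μp μm n} (hc : codebookProb Q c ≠ 0) :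
    0 ≤ realDiv (avgOut Q f e c) (iidPmf Q f n) :=
  realDiv_nonneg (avgOut_nonneg hQ f e c) (iidPmf_nonneg hQ f) (avgOut_eq_zero_of_iidPmf hQ f e c)
    (by rw [sum_iidPmf hQ, sum_avgOut hQ hA f e hc])

end AvgOut

/-- An exponentially small bound for the divergence in soft covering with rates `R`. -/
noncomputable def coveringBound {β : Type*} (Q : Sample 𝒜 𝒳 → ℝ) (f : Sample 𝒜 𝒳 → β)
    (p : Pair h) (R : Pair h → ℝ) (θ : ℝ) (n : ℕ) : ℝ :=
  ∑ T with p ∉ T, ((4 : ℝ) ^ (Tᶜ : Finset (Pair h)).card) ^ θ / θ *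
    (infoMoment Q f (rvAOn (jSet T)ᶜ) θ / 2 ^ (θ * ∑ s ∈ Tᶜ, R s)) ^ n

theorem tendsto_coveringBound {β : Type*} (hQ : Q ∈ stdSimplex ℝ (Sample 𝒜 𝒳))
    (f : Sample 𝒜 𝒳 → β) (p : Pair h) (R : Pair h → ℝ) (θ : ℝ)
    (hθ : ∀ T, p ∉ T → infoMoment Q f (rvAOn (jSet T)ᶜ) θ < 2 ^ (θ * ∑ s ∈ Tᶜ, R s)) :
    Tendsto (coveringBound Q f p R θ) atTop (𝓝 0) := by
  unfold coveringBound
  rw [show (0 : ℝ) = ∑ T : Finset (Pair h) with p ∉ T, 0 by simp]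
  refine tendsto_finsetSum _ fun T hT => ?_
  have hT' : p ∉ T := (Finset.mem_filter.mp hT).2
  have h2 : (0 : ℝ) < 2 ^ (θ * ∑ s ∈ Tᶜ, R s) := Real.rpow_pos_of_pos two_pos _
  have := (tendsto_pow_atTop_nhds_zero_of_lt_one
    (div_nonneg (infoMoment_nonneg hQ.1 f (rvAOn (jSet T)ᶜ) θ) h2.le)
    ((div_lt_one h2).mpr (hθ T hT'))).const_mul
      (((4 : ℝ) ^ (Tᶜ : Finset (Pair h)).card) ^ θ / θ)
  rwa [mul_zero] at this

/-- There are finitely many `T`, and each condition holds for all small positive `θ`, so a common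
`θ` exists. -/
theorem exists_tilt {β : Type*} [Fintype β] (hQ : Q ∈ stdSimplex ℝ (Sample 𝒜 𝒳))
    (f : Sample 𝒜 𝒳 → β) (p : Pair h) (R : Pair h → ℝ)
    (hR : ∀ T, p ∉ T → mutualInfo Q f (rvAOn (jSet T)ᶜ) < ∑ s ∈ Tᶜ, R s) :
    ∃ θ : ℝ, 0 < θ ∧ θ ≤ 1 ∧ ∀ T, p ∉ T →
      infoMoment Q f (rvAOn (jSet T)ᶜ) θ < 2 ^ (θ * ∑ s ∈ Tᶜ, R s) := by
  have h1 : ∀ᶠ θ in 𝓝[>] (0 : ℝ), ∀ T, p ∉ T →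
      infoMoment Q f (rvAOn (jSet T)ᶜ) θ < 2 ^ (θ * ∑ s ∈ Tᶜ, R s) := by
    refine eventually_all.mpr fun T => ?_
    by_cases hT : p ∈ T
    · exact Eventually.of_forall fun θ hc => (hc hT).elim
    · exact (eventually_infoMoment_lt hQ f _ (hR T hT)).mono fun θ hθ _ => hθ
  obtain ⟨θ, hθ, h0, h01⟩ := (h1.and (Ioc_mem_nhdsGT (zero_lt_one' ℝ))).exists
  exact ⟨θ, h0, h01, hθ⟩

/-- The factor 4 in `hR` allows for two floors per pair, one for each index component. It enters the
bound only through a constant independent of `n`. -/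
theorem sum_codebookProb_mul_realDiv_le {β : Type*} [Fintype β] {K : Pair h → Type*}
    [∀ s, Fintype (K s)] [∀ s, Nonempty (K s)] (hh : 2 ≤ h)
    (hQ : Q ∈ stdSimplex ℝ (Sample 𝒜 𝒳)) (hA : LayeredMarkov Q)
    (f : Sample 𝒜 𝒳 → β) {e : ∀ s, K s → Idx μp μm n s} (he : ∀ s, Function.Injective (e s))
    {R : Pair h → ℝ} (hR : ∀ s, (2 : ℝ) ^ ((n : ℝ) * R s) ≤ 4 * Fintype.card (K s))
    {θ : ℝ} (hθ : 0 < θ) (hθ1 : θ ≤ 1) :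
    ∑ c : Codebook 𝒜 μp μm n, codebookProb Q c * realDiv (avgOut Q f e c) (iidPmf Q f n) ≤
      coveringBound Q f (topPair hh) R θ n := by
  refine (sum_codebookProb_mul_divergence_le hh hQ hA f he hθ hθ1).trans ?_
  refine Finset.sum_le_sum fun T _ => ?_
  have hcard : ∀ s, (0 : ℝ) < Fintype.card (K s) := fun s => Nat.cast_pos.mpr Fintype.card_pos
  have h2 : (0 : ℝ) < 2 ^ (θ * ∑ s ∈ Tᶜ, R s) := Real.rpow_pos_of_pos two_pos _
  have hw : ∏ s ∈ Tᶜ, (Fintype.card (K s) : ℝ)⁻¹ ≤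
      4 ^ (Tᶜ : Finset (Pair h)).card * 2 ^ (-((n : ℝ) * ∑ s ∈ Tᶜ, R s)) := by
    calc ∏ s ∈ Tᶜ, (Fintype.card (K s) : ℝ)⁻¹
        ≤ ∏ s ∈ Tᶜ, (4 * (2 : ℝ) ^ (-((n : ℝ) * R s))) := by
          refine Finset.prod_le_prod (fun s _ => inv_nonneg.mpr (hcard s).le) fun s _ => ?_
          rw [Real.rpow_neg two_pos.le, ← div_eq_mul_inv,
            le_div_iff₀ (Real.rpow_pos_of_pos two_pos _), inv_mul_le_iff₀ (hcard s),
            mul_comm (Fintype.card (K s) : ℝ)]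
          exact hR s
      _ = _ := by
          rw [Finset.prod_mul_distrib, Finset.prod_const, Finset.mul_sum, ← Finset.sum_neg_distrib,
            Real.rpow_sum_of_pos two_pos]
  have hw' : (∏ s ∈ Tᶜ, (Fintype.card (K s) : ℝ)⁻¹) ^ θ ≤
      ((4 : ℝ) ^ (Tᶜ : Finset (Pair h)).card) ^ θ * ((2 ^ (θ * ∑ s ∈ Tᶜ, R s)) ^ n)⁻¹ := by
    refine (Real.rpow_le_rpow (Finset.prod_nonneg fun s _ => inv_nonneg.mpr (hcard s).le) hw
      hθ.le).trans_eq ?_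
    rw [Real.mul_rpow (by positivity) (Real.rpow_nonneg two_pos.le _), ← Real.rpow_mul two_pos.le,
      ← Real.rpow_natCast (2 ^ (θ * ∑ s ∈ Tᶜ, R s)) n, ← Real.rpow_mul two_pos.le,
      ← Real.rpow_neg two_pos.le]
    ring_nf
  rw [div_pow]
  calc (∏ s ∈ Tᶜ, (Fintype.card (K s) : ℝ)⁻¹) ^ θ / θ * infoMoment Q f (rvAOn (jSet T)ᶜ) θ ^ n
      ≤ ((4 : ℝ) ^ (Tᶜ : Finset (Pair h)).card) ^ θ * ((2 ^ (θ * ∑ s ∈ Tᶜ, R s)) ^ n)⁻¹ / θ *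
          infoMoment Q f (rvAOn (jSet T)ᶜ) θ ^ n :=
        mul_le_mul_of_nonneg_right (div_le_div_of_nonneg_right hw' hθ.le)
          (pow_nonneg (infoMoment_nonneg hQ.1 _ _ _) n)
    _ = _ := by ring

theorem outPmf_eq_avgOut {β : Type*} (f : Sample 𝒜 𝒳 → β) (c : Codebook 𝒜 μp μm n) :
    outPmf Q f c = avgOut Q f (fun s (i : Idx μp μm n s) => i) c := by
  funext y
  unfold outPmf avgOut
  simp

theorem outPmfGiven_eq_avgOut {β : Type*} (f : Sample 𝒜 𝒳 → β) (c : Codebook 𝒜 μp μm n)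
    (mm : ∀ s, Fin (numIdx n (μm s))) :
    outPmfGiven Q f c mm =
      avgOut Q f (fun s (i : Fin (numIdx n (μp s))) => ((i, mm s) : Idx μp μm n s)) c := by
  funext y
  unfold outPmfGiven avgOut
  simp

theorem outPmf_eq_average {β : Type*} (f : Sample 𝒜 𝒳 → β) (c : Codebook 𝒜 μp μm n)
    (y : Fin n → β) :
    outPmf Q f c y = (∑ mm, outPmfGiven Q f c mm y) /
      Fintype.card (∀ s, Fin (numIdx n (μm s))) := by
  let E : (∀ s, Idx μp μm n s) ≃
      (∀ s, Fin (numIdx n (μm s))) × (∀ s, Fin (numIdx n (μp s))) :=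
    { toFun := fun m => (fun s => (m s).2, fun s => (m s).1)
      invFun := fun p s => (p.2 s, p.1 s)
      left_inv := fun _ => rfl
      right_inv := fun _ => rfl }
  unfold outPmf outPmfGiven
  rw [← Finset.sum_div, div_div, ← Equiv.sum_comp E.symm, Fintype.sum_prod_type, Fintype.card_pi,
    Finset.prod_mul_distrib]
  simp only [Fintype.card_fin, Nat.cast_prod]
  rfl

/-- Soft covering: the expected divergence of the output from the memoryless law vanishes. -/
theorem tendsto_expOutputDiv (hh : 2 ≤ h) (hQ : Q ∈ stdSimplex ℝ (Sample 𝒜 𝒳))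
    (hA : LayeredMarkov Q) (hμp : ∀ s, 0 ≤ μp s) (hμm : ∀ s, 0 ≤ μm s)
    (hR : ∀ S : Finset (Pair h), topPair hh ∉ S →
      mutualInfo Q rvX (rvAOn (jSet S)ᶜ) < ∑ s ∈ Sᶜ, (μp s + μm s)) :
    Tendsto (fun n => expOutputDiv Q μp μm n) atTop (𝓝 0) := by
  obtain ⟨θ, hθ, hθ1, hT⟩ := exists_tilt hQ rvX (topPair hh) (fun s => μp s + μm s) hR
  have hlog2 : 0 < Real.log 2 := Real.log_pos one_lt_two
  let D : ℕ → ℝ := fun n => ∑ c : Codebook 𝒜 μp μm n, codebookProb Q c *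
    (realDiv (outPmf Q rvX c) (iidPmf Q rvX n) / Real.log 2)
  have hD : ∀ n, expOutputDiv Q μp μm n = (D n : EReal) := by
    intro n
    unfold expOutputDiv
    rw [← expect_coe]
    congr 1
    funext c
    rw [outPmf_eq_avgOut]
    -- Absolute continuity holds for every codebook, including those of probability zero, so the
    -- value `⊤` never occurs.
    exact klDiv_eq_coe (avgOut_eq_zero_of_iidPmf hQ _ _ c)
  simp only [hD]
  refine (continuous_coe_real_ereal.tendsto 0).comp ?_
  have hne : ∀ n s, Nonempty (Idx μp μm n s) := fun n s =>
    ⟨(⟨0, numIdx_pos (hμp s) n⟩, ⟨0, numIdx_pos (hμm s) n⟩)⟩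
  have hb := (tendsto_coveringBound hQ rvX (topPair hh) _ θ hT).div_const (Real.log 2)
  rw [zero_div] at hb
  refine squeeze_zero (fun n => ?_) (fun n => ?_) hb
  · refine Finset.sum_nonneg fun c _ => ?_
    by_cases hc : codebookProb Q c = 0
    · rw [hc, zero_mul]
    · refine mul_nonneg (codebookProb_nonneg hQ c) (div_nonneg ?_ hlog2.le)
      rw [outPmf_eq_avgOut]
      exact realDiv_avgOut_nonneg hQ hA _ _ hc
  · simp only [D, ← mul_div_assoc, ← Finset.sum_div, outPmf_eq_avgOut]
    refine div_le_div_of_nonneg_right (sum_codebookProb_mul_realDiv_le hh hQ hA rvX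
      (fun s => Function.injective_id) (fun s => ?_) hθ hθ1) hlog2.le
    have h1 := two_rpow_le_two_mul_numIdx (hμp s) n
    have h2 := two_rpow_le_two_mul_numIdx (hμm s) n
    rw [mul_add, Real.rpow_add two_pos]
    simp only [Fintype.card_prod, Fintype.card_fin, Nat.cast_mul]
    calc (2 : ℝ) ^ ((n : ℝ) * μp s) * 2 ^ ((n : ℝ) * μm s)
        ≤ (2 * numIdx n (μp s)) * (2 * numIdx n (μm s)) :=
          mul_le_mul h1 h2 (Real.rpow_nonneg two_pos.le _) (by positivity)
      _ = _ := by ring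

/-- Secrecy: the expected dependence of the output on the indices `m^-` vanishes. -/
theorem tendsto_expDependence (hh : 2 ≤ h) (hQ : Q ∈ stdSimplex ℝ (Sample 𝒜 𝒳))
    (hA : LayeredMarkov Q) (k : Fin h) (hμp : ∀ s, 0 ≤ μp s) (hμm : ∀ s, 0 ≤ μm s)
    (hR : ∀ S : Finset (Pair h), topPair hh ∉ S →
      mutualInfo Q (rvXAt k) (rvAOn (jSet S)ᶜ) < ∑ s ∈ Sᶜ, μp s) :
    Tendsto (fun n => expDependence Q k μp μm n) atTop (𝓝 0) := by
  obtain ⟨θ, hθ, hθ1, hT⟩ := exists_tilt hQ (rvXAt k) (topPair hh) μp hR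
  have hlog2 : 0 < Real.log 2 := Real.log_pos one_lt_two
  have hnep : ∀ n s, Nonempty (Fin (numIdx n (μp s))) := fun n s => ⟨⟨0, numIdx_pos (hμp s) n⟩⟩
  have hnem : ∀ n s, Nonempty (Fin (numIdx n (μm s))) := fun n s => ⟨⟨0, numIdx_pos (hμm s) n⟩⟩
  have hne : ∀ n s, Nonempty (Idx μp μm n s) := fun n s =>
    ⟨(⟨0, numIdx_pos (hμp s) n⟩, ⟨0, numIdx_pos (hμm s) n⟩)⟩
  have hcard : ∀ n, (∏ s, (numIdx n (μm s) : ℝ)) =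
      Fintype.card (∀ s, Fin (numIdx n (μm s))) := by
    intro n
    simp [Fintype.card_pi]
  have hpos : ∀ n, (0 : ℝ) < Fintype.card (∀ s, Fin (numIdx n (μm s))) := fun n =>
    Nat.cast_pos.mpr Fintype.card_pos
  have hG0 : ∀ n (c : Codebook 𝒜 μp μm n) mm y, 0 ≤ outPmfGiven Q (rvXAt k) c mm y := by
    intro n c mm y
    rw [outPmfGiven_eq_avgOut]
    exact avgOut_nonneg hQ _ _ _ _
  have hO0 : ∀ n (c : Codebook 𝒜 μp μm n) y, 0 ≤ outPmf Q (rvXAt k) c y := by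
    intro n c y
    rw [outPmf_eq_avgOut]
    exact avgOut_nonneg hQ _ _ _ _
  have hac : ∀ n (c : Codebook 𝒜 μp μm n) mm y, outPmf Q (rvXAt k) c y = 0 →
      outPmfGiven Q (rvXAt k) c mm y = 0 := by
    intro n c mm y hy
    -- The output pmf is an average of the nonnegative conditional ones; where it vanishes, all of
    -- them do.
    rw [outPmf_eq_average, div_eq_zero_iff, or_iff_left (hpos n).ne'] at hy
    exact (Finset.sum_eq_zero_iff_of_nonneg fun i _ => hG0 n c i y).mp hy mm (Finset.mem_univ mm)
  let D : ℕ → ℝ := fun n => ∑ mm : ∀ s, Fin (numIdx n (μm s)),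
    (∑ c : Codebook 𝒜 μp μm n, codebookProb Q c *
      (realDiv (outPmfGiven Q (rvXAt k) c mm) (outPmf Q (rvXAt k) c) / Real.log 2)) /
        Fintype.card (∀ s, Fin (numIdx n (μm s)))
  have hD : ∀ n, expDependence Q k μp μm n = (D n : EReal) := by
    intro n
    unfold expDependence
    rw [coe_sum_eReal]
    refine Finset.sum_congr rfl fun mm _ => ?_
    rw [EReal.coe_div, hcard, ← expect_coe]
    congr 2
    funext c
    exact klDiv_eq_coe (hac n c mm)
  simp only [hD]
  refine (continuous_coe_real_ereal.tendsto 0).comp ?_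
  have hb := (tendsto_coveringBound hQ (rvXAt k) (topPair hh) _ θ hT).div_const (Real.log 2)
  rw [zero_div] at hb
  refine squeeze_zero (fun n => ?_) (fun n => ?_) hb
  · refine Finset.sum_nonneg fun mm _ => div_nonneg (Finset.sum_nonneg fun c _ => ?_) (hpos n).le
    by_cases hc : codebookProb Q c = 0
    · rw [hc, zero_mul]
    · refine mul_nonneg (codebookProb_nonneg hQ c) (div_nonneg ?_ hlog2.le)
      refine realDiv_nonneg (hG0 n c mm) (hO0 n c) (hac n c mm) ?_
      rw [outPmf_eq_avgOut, outPmfGiven_eq_avgOut, sum_avgOut hQ hA _ _ hc,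
        sum_avgOut hQ hA _ _ hc]
  -- Passing to the i.i.d. reference uses that its divergence from the mixture is nonnegative. This
  -- is only available for codebooks of positive probability, where the outputs are normalized.
  · have hmean : ∀ c : Codebook 𝒜 μp μm n, codebookProb Q c *
        ∑ mm, realDiv (outPmfGiven Q (rvXAt k) c mm) (outPmf Q (rvXAt k) c) ≤
        codebookProb Q c *
          ∑ mm, realDiv (outPmfGiven Q (rvXAt k) c mm) (iidPmf Q (rvXAt k) n) := by
      intro c
      by_cases hc : codebookProb Q c = 0
      · rw [hc, zero_mul, zero_mul]
      · refine mul_le_mul_of_nonneg_left (sum_realDiv_average_le (hG0 n c)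
          (outPmf_eq_average (rvXAt k) c) ?_ ?_) (codebookProb_nonneg hQ c)
        · rw [outPmf_eq_avgOut]
          exact avgOut_eq_zero_of_iidPmf hQ _ _ c
        · rw [outPmf_eq_avgOut]
          exact realDiv_avgOut_nonneg hQ hA _ _ hc
    have hcover : ∀ mm : ∀ s, Fin (numIdx n (μm s)), ∑ c : Codebook 𝒜 μp μm n, codebookProb Q c *
        realDiv (outPmfGiven Q (rvXAt k) c mm) (iidPmf Q (rvXAt k) n) ≤
        coveringBound Q (rvXAt k) (topPair hh) μp θ n := by
      intro mm
      simp only [outPmfGiven_eq_avgOut]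
      -- With `mm` fixed, the tuples are embedded by their `m^+` component alone, so the covering
      -- rates are `μp`. The bound does not depend on `mm`.
      refine sum_codebookProb_mul_realDiv_le hh hQ hA _ (fun s i j hij => (Prod.mk.inj hij).1)
        (fun s => ?_) hθ hθ1
      have h1 := two_rpow_le_two_mul_numIdx (hμp s) n
      have h2 : (0 : ℝ) ≤ numIdx n (μp s) := Nat.cast_nonneg _
      rw [Fintype.card_fin]
      linarith
    calc D n = (∑ c : Codebook 𝒜 μp μm n, codebookProb Q c *
          ∑ mm, realDiv (outPmfGiven Q (rvXAt k) c mm) (outPmf Q (rvXAt k) c)) /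
            Fintype.card (∀ s, Fin (numIdx n (μm s))) / Real.log 2 := by
          simp only [D, ← Finset.sum_div, Finset.mul_sum, ← mul_div_assoc]
          rw [Finset.sum_comm, div_right_comm]
      _ ≤ (∑ c : Codebook 𝒜 μp μm n, codebookProb Q c *
          ∑ mm, realDiv (outPmfGiven Q (rvXAt k) c mm) (iidPmf Q (rvXAt k) n)) /
            Fintype.card (∀ s, Fin (numIdx n (μm s))) / Real.log 2 :=
          div_le_div_of_nonneg_right (div_le_div_of_nonneg_right
            (Finset.sum_le_sum fun c _ => hmean c) (hpos n).le) hlog2.le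
      _ ≤ coveringBound Q (rvXAt k) (topPair hh) μp θ n / Real.log 2 := by
          refine div_le_div_of_nonneg_right ?_ hlog2.le
          rw [div_le_iff₀ (hpos n)]
          simp only [Finset.mul_sum]
          rw [Finset.sum_comm]
          refine (Finset.sum_le_sum fun mm _ => hcover mm).trans_eq ?_
          rw [Finset.sum_const, Finset.card_univ, nsmul_eq_mul, mul_comm]

end Assembly

end LineCoord

theorem theorem1 {h : ℕ} (hh : 2 ≤ h)
    {𝒜 : Pair h → Type*} {𝒳 : Fin h → Type*}
    [∀ s, Fintype (𝒜 s)] [∀ k, Fintype (𝒳 k)]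
    (Q : Sample 𝒜 𝒳 → ℝ) (hQ : Q ∈ stdSimplex ℝ (Sample 𝒜 𝒳)) (hA : LayeredMarkov Q)
    (μp μm : Pair h → ℝ) (hμp : ∀ s, 0 ≤ μp s) (hμm : ∀ s, 0 ≤ μm s) :
    ((∀ S : Finset (Pair h), topPair hh ∉ S →
        mutualInfo Q rvX (rvAOn (jSet S)ᶜ) < ∑ s ∈ Sᶜ, (μp s + μm s)) →
      Tendsto (fun n => expOutputDiv Q μp μm n) atTop (𝓝 0)) ∧
    ((∀ S : Finset (Pair h), topPair hh ∉ S →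
        mutualInfo Q (rvXAt (firstNode hh)) (rvAOn (jSet S)ᶜ) < ∑ s ∈ Sᶜ, μp s) →
      Tendsto (fun n => expDependence Q (firstNode hh) μp μm n) atTop (𝓝 0)) :=
  ⟨tendsto_expOutputDiv hh hQ hA hμp hμm, tendsto_expDependence hh hQ hA (firstNode hh) hμp hμm⟩
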